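/- **Setting.** Let $\mathcal X,\mathcal G,\mathsf M$ be the sets of local variables, global variables and mutexes, $\mathcal V$ the set of values, $\mathcal I\subseteq\mathcal V$ the thread ids, $\mathsf{self}\in\mathcal X$ the local holding the id of the current thread. A program is a control-flow graph with edges $(u,A,u')\in\mathcal E$ and start point $u_0$, where $A$ is a guard $r$, an assignment $x=r$ ($r$ an expression over locals), $x=\mathsf{create}(u_1)$, $\mathsf{lock}(a)$, $\mathsf{unlock}(a)$, a read $x=g$ or a write $g=x$. Each access $A$ to a global $g$ occurs as $\mathsf{lock}(m_g);A;\mathsf{unlock}(m_g)$ for a mutex $m_g\in\mathsf M$ associated with $g$. *Local traces.* A node is a triple $(j,u,\sigma)$ with $j\in\mathbb N$, $u$ a program point and $\sigma:\mathcal X\to\mathcal V$; it belongs to thread $\sigma\,\mathsf{self}$. A global trace consists of a graph that is the union of finite single-thread runs with distinct thread ids (each run $\bar u_0A_1\bar u_1\dots A_n\bar u_n$ with $\bar u_j=(j,u_j,\sigma_j)$ follows the edges of the program and the local effect of their actions, with arbitrary values read from globals and arbitrary ids assigned by $\mathsf{create}$), a create order $\to_c$ and locking orders $\to_a$ ($a\in\mathsf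 M$), such that: the union of program order, $\to_c$ and all $\to_a$ is acyclic, its reflexive-transitive closure $\le$ (causality) has a least element $\mathbf 0=(0,u_0,\sigma_0)$ with $\sigma_0\,\mathsf{self}$ the initial thread id; every first node of a thread other than $\mathbf 0$ has exactly one $\to_c$-predecessor, every node has at most one $\to_c$-successor, and $z=(j,u,\sigma)\to_c(0,v,\sigma')$ implies that the program has an edge $(u,x=\mathsf{create}(v),\cdot)$, that $\sigma'$ and $\sigma$ agree except possibly at $\mathsf{self}$, and that the program-order edge of the trace leaving $z$, if there is one, is labelled $x=\mathsf{create}(v)$ for some $x$ whose value after that edge is $\sigma'\,\mathsf{self}$; $\to_a$ leads from $\mathbf 0$ or ends of $\mathsf{unlock}(a)$ edges to ends of $\mathsf{lock}(a)$ edges, each end of a $\mathsf{lock}(a)$ edge has exactly one $\to_a$-predecessor and each node at most one $\to_a$-successor; no thread locks a mutex it holds or unlocks one it does not hold; and for each read edge $x=g$ with source $\bar v$, there is a write to $g$ whose end is $\le$-maximal among the ends $\le\bar v$ of writes to $g$, and the read yields its value. A local trace $t$ is a global trace with a greatest node, its sink; the thread of the sink is the ego thread, and $\mathsf{loc}(t)$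 and $t(x)$ are the program point and the value of $x$ at the sink; $\mathsf{last}(t)$ is the last action of the ego thread. *Operations and semantics.* Let $\mathsf{init}$ be the set of one-node local traces at $u_0$ with the initial thread id and arbitrary other locals, and let $\nu$ assign to each trace an id for a thread created at its end. $\mathsf{new}\,u_1\,t$ is the set of (at most one) local traces extending $t$ by a new thread starting at $u_1$ with id $\nu(t)$ and otherwise the locals of the sink of $t$, created at the sink of $t$; for $e=(u,A,u')$, $[\![e]\!](t_0)$ (and $[\![e]\!](t_0,t_1)$ for $A=\mathsf{lock}(a)$, where $t_1\in\mathsf{init}$ or $\mathsf{last}(t_1)=\mathsf{unlock}(a)$) is the set of local traces obtained by extending $t_0$ (merged with $t_1$, where the sink of $t_1$ becomes the $\to_a$-predecessor of the new sink) by executing $e$ at the sink of $t_0$ (which lies at $u$); $x=\mathsf{create}(u_1)$ assigns $\nu(t_0)$ to $x$. $\mathcal T$ is the least set of traces containing $\mathsf{init}$ and closed under all these operations. The local trace semantics $\eta$ is the least solution of the constraint system $\mathcal C$ over unknowns $[u]$, $[a]$ with sets of traces as values: $[u_0]\supseteq\mathsf{init}$, $[a]\supseteq\mathsf{init}$, and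 for each edge $e=(u,A,u')$: $[u']\supseteq[\![e]\!](\eta[u])$ (for $A=\mathsf{lock}(a)$: $[u']\supseteq[\![e]\!](\eta[u],\eta[a])$), where $\mathsf{unlock}(a)$ additionally contributes $[\![e]\!](\eta[u])$ to $[a]$ and $x=\mathsf{create}(u_1)$ contributes $\mathsf{new}\,u_1\,(\eta[u])$ to $[u_1]$. *The analysis.* Let $\mathcal D$ be a complete lattice with monotone concretization $\gamma_{\mathcal D}:\mathcal D\to2^{\mathcal V}$, $\gamma_{\mathcal D}(\top)=\mathcal V$, with sound abstract evaluation $[\![r]\!]^\sharp$ of expressions, sound abstract guards, and abstract thread ids $\nu^\sharp$ which are sound: $\nu(t)\in\gamma_{\mathcal D}(\nu^\sharp\,u\,s\,u_1)$ whenever a $\mathsf{create}(u_1)$ edge leaves $u$ and $t\in\gamma_{u,S}(s)$ for some $S$ (see below). The system $\mathcal C_2$ (Lock-Centered Reading) has unknowns $[g,a,S]$ with values in $\mathcal D$ and $[u,S]$ ($S\subseteq\mathsf M$) whose values are triples $(V,L,\sigma)$: $V:\mathsf M\to2^{\mathcal G}$ (ordered by $\supseteq$), $L$ mapping mutexes to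 upward-closed sets of locksets (ordered by $\subseteq$; $\{S\}$ denotes the upward closure), $\sigma:\mathcal X\cup\mathcal G\to\mathcal D$. Its constraints are: $[u_0,\emptyset]\sqsupseteq(a\mapsto\emptyset,\;a\mapsto\emptyset,\;\{x\mapsto\top\}\cup\{g\mapsto\bot\})$, and, for each edge $(u,A,u')$ and each $S$, with $(V,L,\sigma)=\eta_2[u,S]$, the constraint $[u',S']\sqsupseteq s$ (where $S'=S\cup\{a\}$ for $A=\mathsf{lock}(a)$, $S'=S\setminus\{a\}$ for $A=\mathsf{unlock}(a)$, and $S'=S$ otherwise) with - guard $r$, assignment $x=r$: $s=(V,L,\sigma')$ with $\sigma'$ the abstract guard applied to $\sigma$, resp. $\sigma\oplus\{x\mapsto[\![r]\!]^\sharp\sigma\}$; - $x=\mathsf{create}(u_1)$: with $i=\nu^\sharp\,u\,(V,L,\sigma)\,u_1$, $s=(V,L,\sigma\oplus\{x\mapsto i\})$, and the side-effect $[u_1,\emptyset]\sqsupseteq(a\mapsto\emptyset,\;a\mapsto\emptyset,\;\sigma\oplus(\{\mathsf{self}\mapsto i\}\cup\{g\mapsto\bot\mid g\in\mathcal G\}))$;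 - $\mathsf{lock}(a)$: $s=(V\oplus\{a\mapsto\emptyset\},L\oplus\{a\mapsto\{S\}\},\sigma)$; - $\mathsf{unlock}(a)$: $s=(V,L,\sigma)$, and the side-effects $[g,a,S\setminus\{a\}]\sqsupseteq\sigma\,g$ for all $g\in\mathcal G$; - $g=x$: $s=(\{a\mapsto V\,a\cup\{g\}\},L,\sigma\oplus\{g\mapsto\sigma\,x\})$; - $x=g$: $s=(V,L,\sigma\oplus\{x\mapsto\sigma\,g\sqcup d\})$ with $d=\bigsqcup\{\eta_2[g,a,S']\mid a\in\mathsf M,\ g\notin V\,a,\ B\in L\,a,\ B\cap S'=\emptyset\}$. A post-solution is an assignment $\eta_2$ of the unknowns that satisfies all constraints and side-effects. *Concretization.* For a local trace $t$ let $\beta\,t=(V,L,\sigma)$, where $V\,a$ is the set of globals written by the ego thread since it last acquired $a$ (since its start, if it never acquired $a$), $L\,a=\{B\}$ for the lockset $B$ held by the ego thread just before its last $\mathsf{lock}(a)$ and $L\,a=\emptyset$ if there is none, $\sigma\,x=\{t(x)\}$ for locals $x$, and $\sigma\,g$ contains just the value of the ego thread's last write to $g$, if any. Let $\mathcal T_S$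 be the set of $t\in\mathcal T$ with lockset $S$ held by the ego thread at the sink. Then $\gamma_{u,S}(V^\sharp,L^\sharp,\sigma^\sharp)$ is the set of $t\in\mathcal T_S$ with $\mathsf{loc}(t)=u$, $\beta\,t=(V,L,\sigma)$, $V\sqsubseteq V^\sharp$, $L\sqsubseteq L^\sharp$ and $\sigma\subseteq\gamma_{\mathcal D}\circ\sigma^\sharp$ pointwise; and $\gamma_{g,a,S}(d)$ is the set of $t\in\mathcal T_S$ with $\mathsf{last}(t)=\mathsf{unlock}(a)$ such that the ego thread has not written $g$ or the value of its last write to $g$ lies in $\gamma_{\mathcal D}(d)$. **Theorem.** The system $\mathcal C$ has a least solution $\eta$, and: 1. Every post-solution $\eta_2$ of $\mathcal C_2$ is sound w.r.t. the local trace semantics: for all $u,g,a,S$, every trace in $\eta[u]$ at whose sink the ego thread holds the lockset $S$ is in $\gamma_{u,S}(\eta_2[u,S])$, and every trace in $\eta[a]$ at whose sink the ego thread holds the lockset $S$ is in $\mathsf{init}\cup\gamma_{g,a,S}(\eta_2[g,a,S])$. 2. Let $t\in\eta[u]$ with $\mathsf{last}(t)$ a read $x=g$, and let $V,L$ be the first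 two components of $\beta\,t$. Then $t$ has a last write to $g$ (with respect to $\le$), $t(x)$ is the value it writes, and this write either is the ego thread's last write to $g$ in $t$, or is the last write to $g$ by the ego thread of some trace $t'\in\eta[a]$ at whose sink that thread holds a lockset $S'$, where $L\,a=\{B\}$ (so $a$ was acquired by the ego thread of $t$), $B\cap S'=\emptyset$ and $g\notin V\,a$. -/

import Mathlib

universe u

namespace LockCentered

/-! ### Side-effecting constraint systems -/

/-- A side-effecting constraint `x ⊒ f_x`. The right-hand side maps an assignment of the unknowns to
the collection of its side-effects (`⊥` at the unknowns without side-effect), together with its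
contribution to the left-hand side. -/
structure SEConstraint {Un : Type u} (Dom : Un → Type u) where
  lhs : Un
  rhs : (∀ x, Dom x) → (∀ x, Dom x) × Dom lhs

/-- `η` is a (post-)solution: all side-effects and all contributions are accounted for by `η`. -/
def IsPostSolution {Un : Type u} {Dom : Un → Type u} [∀ x, CompleteLattice (Dom x)]
    (C : Set (SEConstraint Dom)) (η : ∀ x, Dom x) : Prop :=
  ∀ c ∈ C, (c.rhs η).1 ≤ η ∧ (c.rhs η).2 ≤ η c.lhs

open Classical in
/-- The collection of side-effects consisting of the single side-effect `x ↦ d`. -/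
noncomputable def effect {Un : Type u} {Dom : Un → Type u} [∀ x, CompleteLattice (Dom x)]
    (x : Un) (d : Dom x) : ∀ y, Dom y :=
  Function.update ⊥ x d

/-! ### Programs and local traces -/

/-- Actions: guards, assignments `x = r` to locals, `x = create(u₁)`, `lock(a)`, `unlock(a)`, reads
`x = g` and writes `g = x` of globals. -/
inductive Action (N X G M Ex : Type u) : Type u
  | guard (r : Ex)
  | assign (x : X) (r : Ex)
  | create (x : X) (u₁ : N)
  | lock (a : M)
  | unlock (a : M)
  | read (x : X) (g : G)
  | write (g : G) (x : X)

/-- A node `(j, u, σ)`. -/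
@[ext]
structure Node (N X Val : Type u) : Type u where
  idx : ℕ
  pt : N
  st : X → Val

/-- The data of a local trace: a graph of nodes and labelled program-order edges, the create order,
the locking orders, and the distinguished node at which the trace ends. -/
@[ext]
structure Trace (N X G M Ex Val : Type u) : Type u where
  nodes : Set (Node N X Val)
  acts : Set (Node N X Val × Action N X G M Ex × Node N X Val)
  cr : Node N X Val → Node N X Val → Prop
  lk : M → Node N X Val → Node N X Val → Prop
  sink : Node N X Val

/-- A program (control-flow graph) with values, thread ids, expression evaluation, the mutex `m_g`
of each global `g`, and the function `ν` providing the ids of created threads. -/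
structure Program (N X G M Ex Val : Type u) : Type u where
  edges : Set (N × Action N X G M Ex × N)
  start : N
  self : X
  ids : Set Val
  tid0 : Val
  tid0_mem : tid0 ∈ ids
  /-- the value encoding *false* -/
  zero : Val
  eval : Ex → (X → Val) → Val
  mutexOf : G → M
  nu : Trace N X G M Ex Val → Val
  nu_mem : ∀ t, nu t ∈ ids

/-- The action reads or writes the global `g`. -/
def Action.Accesses {N X G M Ex : Type u} (A : Action N X G M Ex) (g : G) : Prop :=
  (∃ x, A = .read x g) ∨ (∃ x, A = .write g x)

/-- A finite sequence `ū₀ A₀ ū₁ … A_{len-1} ū_len`; entries beyond `len` are irrelevant. -/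
structure RawTrace (N X G M Ex Val : Type u) : Type u where
  len : ℕ
  pt : ℕ → N
  st : ℕ → X → Val
  act : ℕ → Action N X G M Ex

section

variable {N X G M Ex Val : Type u}

def RawTrace.node (ρ : RawTrace N X G M Ex Val) (j : ℕ) : Node N X Val := ⟨j, ρ.pt j, ρ.st j⟩

def RawTrace.nodes (ρ : RawTrace N X G M Ex Val) : Set (Node N X Val) :=
  {v | ∃ j ≤ ρ.len, v = ρ.node j}

def RawTrace.acts (ρ : RawTrace N X G M Ex Val) :
    Set (Node N X Val × Action N X G M Ex × Node N X Val) :=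
  {e | ∃ j < ρ.len, e = (ρ.node j, ρ.act j, ρ.node (j + 1))}

namespace Program

variable (P : Program N X G M Ex Val)

/-- Each access to a global `g` occurs as `lock(m_g); A; unlock(m_g)`. -/
def AtomicAccesses : Prop :=
  ∀ u A u' g, (u, A, u') ∈ P.edges → A.Accesses g →
    u ≠ P.start ∧
    (∀ v x v', (v, Action.create x u, v') ∉ P.edges) ∧
    (∀ v B, (v, B, u) ∈ P.edges → B = .lock (P.mutexOf g)) ∧
    (∀ B v, (u', B, v) ∈ P.edges → B = .unlock (P.mutexOf g))

open Classical in
/-- Local state transitions of one thread; reads and thread creation are unconstrained here up to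
the shape of the resulting state. -/
def Step : Action N X G M Ex → (X → Val) → (X → Val) → Prop
  | .guard r, σ, σ' => P.eval r σ ≠ P.zero ∧ σ' = σ
  | .assign x r, σ, σ' => σ' = Function.update σ x (P.eval r σ)
  | .create x _, σ, σ' => ∃ i ∈ P.ids, σ' = Function.update σ x i
  | .lock _, σ, σ' => σ' = σ
  | .unlock _, σ, σ' => σ' = σ
  | .read x _, σ, σ' => ∃ d, σ' = Function.update σ x d
  | .write _ _, σ, σ' => σ' = σ

/-- `ρ` is a raw trace of the single thread with id `i`. -/
def IsRaw (i : Val) (ρ : RawTrace N X G M Ex Val) : Prop :=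
  (∀ j ≤ ρ.len, ρ.st j P.self = i) ∧
  ∀ j < ρ.len, (ρ.pt j, ρ.act j, ρ.pt (j + 1)) ∈ P.edges ∧
    P.Step (ρ.act j) (ρ.st j) (ρ.st (j + 1))

/-- The id of the thread to which a node belongs. -/
def tid (v : Node N X Val) : Val := v.st P.self

/-- Nodes of the form `(0, u₀, σ₀)` with `σ₀ self = 0`. -/
def IsRoot (v : Node N X Val) : Prop := v.idx = 0 ∧ v.pt = P.start ∧ P.tid v = P.tid0

end Program

namespace Trace

variable (t : Trace N X G M Ex Val)

/-- The union of the program order, the create order and the locking orders. -/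
def Imm (v w : Node N X Val) : Prop :=
  (∃ A, (v, A, w) ∈ t.acts) ∨ t.cr v w ∨ ∃ a, t.lk a v w

/-- The causality order. -/
def Le : Node N X Val → Node N X Val → Prop := Relation.ReflTransGen t.Imm

/-- `last_write_g t = (w, g = y, w')`. -/
def IsLastWrite (g : G) (w : Node N X Val) (y : X) (w' : Node N X Val) : Prop :=
  (w, Action.write g y, w') ∈ t.acts ∧
  ∀ z y' z', (z, Action.write g y', z') ∈ t.acts → t.Le z' w'

/-- The last action of the ego thread is `A`. -/
def LastIs (A : Action N X G M Ex) : Prop := ∃ v, (v, A, t.sink) ∈ t.acts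

end Trace

namespace Program

variable (P : Program N X G M Ex Val) (t : Trace N X G M Ex Val)

/-- The mutexes which the thread of `v` has acquired and, at `v`, not yet released. -/
def lockset (v : Node N X Val) : Set M :=
  {a | ∃ w w', (w, Action.lock a, w') ∈ t.acts ∧ P.tid w' = P.tid v ∧ w'.idx ≤ v.idx ∧
    ∀ z z', (z, Action.unlock a, z') ∈ t.acts → P.tid z' = P.tid v → z'.idx ≤ v.idx →
      z'.idx < w'.idx}

open Classical in
/-- Global traces. As a local trace only contains the causal past of its end, the node at which a
thread is created need not have its outgoing `create` edge inside the trace: it is required that the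
control-flow graph offers that edge, and that the edge taken inside the trace, if any, is a
matching `create` edge. -/
structure IsGlobalTrace : Prop where
  /-- the graph is the union of raw traces of threads with distinct ids -/
  raw : ∃ (I : Set Val) (ρ : Val → RawTrace N X G M Ex Val), I ⊆ P.ids ∧
    (∀ i ∈ I, P.IsRaw i (ρ i)) ∧
    t.nodes = {v | ∃ i ∈ I, v ∈ (ρ i).nodes} ∧ t.acts = {e | ∃ i ∈ I, e ∈ (ρ i).acts}
  /-- the causality order is a partial order (the generating relation has no cycles) -/
  acyclic : ∀ v, ¬ Relation.TransGen t.Imm v v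
  /-- with least element `(0, u₀, σ₀)` -/
  root : ∃ r ∈ t.nodes, P.IsRoot r ∧ ∀ v ∈ t.nodes, t.Le r v
  cr_dom : ∀ z s, t.cr z s → z ∈ t.nodes ∧ s ∈ t.nodes ∧ s.idx = 0 ∧ ¬ P.IsRoot s ∧
    (∃ x v, (z.pt, Action.create x s.pt, v) ∈ P.edges) ∧
    s.st = Function.update z.st P.self (P.tid s) ∧
    ∀ A z', (z, A, z') ∈ t.acts → ∃ x, A = .create x s.pt ∧ z'.st x = P.tid s
  cr_pred : ∀ s ∈ t.nodes, s.idx = 0 → ¬ P.IsRoot s → ∃! z, t.cr z s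
  cr_succ : ∀ z s s', t.cr z s → t.cr z s' → s = s'
  lk_dom : ∀ a z y, t.lk a z y → z ∈ t.nodes ∧
    (P.IsRoot z ∨ ∃ w, (w, Action.unlock a, z) ∈ t.acts) ∧ ∃ w, (w, Action.lock a, y) ∈ t.acts
  lk_succ : ∀ a z y y', t.lk a z y → t.lk a z y' → y = y'
  lk_pred : ∀ a w y, (w, Action.lock a, y) ∈ t.acts → ∃! z, t.lk a z y
  /-- mutexes are not re-entrant -/
  lock_free : ∀ a v v', (v, Action.lock a, v') ∈ t.acts → a ∉ P.lockset t v
  /-- mutexes are only released by a thread that holds them -/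
  unlock_held : ∀ a v v', (v, Action.unlock a, v') ∈ t.acts → a ∈ P.lockset t v
  /-- the value read for a global is the last value written to it -/
  globals : ∀ x g v v', (v, Action.read x g, v') ∈ t.acts →
    ∃ w y w', (w, Action.write g y, w') ∈ t.acts ∧ t.Le w' v ∧
      (∀ z y' z', (z, Action.write g y', z') ∈ t.acts → t.Le z' v → t.Le w' z' → z' = w') ∧
      v'.st x = w.st y

/-- Local traces: global traces whose last node is above all nodes (for finite traces: is the
unique maximal node). -/
structure IsLocalTrace : Prop extends P.IsGlobalTrace t where
  sink_mem : t.sink ∈ t.nodes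
  sink_max : ∀ v ∈ t.nodes, t.Le v t.sink

/-- The initial local trace `0_σ`. -/
def initTrace (σ : X → Val) : Trace N X G M Ex Val where
  nodes := {⟨0, P.start, σ⟩}
  acts := ∅
  cr _ _ := False
  lk _ _ _ := False
  sink := ⟨0, P.start, σ⟩

def init : Set (Trace N X G M Ex Val) := {t | ∃ σ, σ P.self = P.tid0 ∧ t = P.initTrace σ}

open Classical in
/-- `new u₁ t`: the trace of a thread created at the end of `t` and starting at `u₁`. -/
def new (u₁ : N) (t : Trace N X G M Ex Val) : Set (Trace N X G M Ex Val) :=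
  {t' | P.IsLocalTrace t' ∧
    t'.sink = ⟨0, u₁, Function.update t.sink.st P.self (P.nu t)⟩ ∧
    t'.nodes = insert t'.sink t.nodes ∧
    t'.acts = t.acts ∧
    (∀ v w, t'.cr v w ↔ t.cr v w ∨ (v = t.sink ∧ w = t'.sink)) ∧
    t'.lk = t.lk}

open Classical in
/-- `⟦(u, A, u')⟧ t₀` for actions `A` other than `lock`. -/
def sem (u : N) (A : Action N X G M Ex) (u' : N) (t₀ : Trace N X G M Ex Val) :
    Set (Trace N X G M Ex Val) :=
  {t' | P.IsLocalTrace t' ∧ t₀.sink.pt = u ∧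
    t'.sink.idx = t₀.sink.idx + 1 ∧ t'.sink.pt = u' ∧
    P.Step A t₀.sink.st t'.sink.st ∧
    (∀ x u₁, A = .create x u₁ → t'.sink.st = Function.update t₀.sink.st x (P.nu t₀)) ∧
    t'.nodes = insert t'.sink t₀.nodes ∧
    t'.acts = insert (t₀.sink, A, t'.sink) t₀.acts ∧
    t'.cr = t₀.cr ∧ t'.lk = t₀.lk}

/-- `⟦(u, lock(a), u')⟧ (t₀, t₁)`: the merge of `t₀` with the trace `t₁` which is initial or ends in
`unlock(a)`, extended by the acquisition of `a`. -/
def semLock (u : N) (a : M) (u' : N) (t₀ t₁ : Trace N X G M Ex Val) :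
    Set (Trace N X G M Ex Val) :=
  {t' | P.IsLocalTrace t' ∧ (t₁ ∈ P.init ∨ t₁.LastIs (.unlock a)) ∧ t₀.sink.pt = u ∧
    t'.sink = ⟨t₀.sink.idx + 1, u', t₀.sink.st⟩ ∧
    t'.nodes = insert t'.sink (t₀.nodes ∪ t₁.nodes) ∧
    t'.acts = insert (t₀.sink, .lock a, t'.sink) (t₀.acts ∪ t₁.acts) ∧
    (∀ v w, t'.cr v w ↔ t₀.cr v w ∨ t₁.cr v w) ∧
    (∀ b v w, t'.lk b v w ↔
      t₀.lk b v w ∨ t₁.lk b v w ∨ (b = a ∧ v = t₁.sink ∧ w = t'.sink))}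

/-- The set `𝒯` of all local traces of the program: the least set containing the initial traces and
closed under `new` and the operations of the control-flow edges. -/
inductive Traces (P : Program N X G M Ex Val) : Trace N X G M Ex Val → Prop
  | init (t₀ : Trace N X G M Ex Val) : t₀ ∈ P.init → Traces P t₀
  | new (t₀ t' : Trace N X G M Ex Val) (u₁ : N) : Traces P t₀ → t' ∈ P.new u₁ t₀ → Traces P t'
  | edge (t₀ t' : Trace N X G M Ex Val) (u : N) (A : Action N X G M Ex) (u' : N) :
      (u, A, u') ∈ P.edges → (∀ a, A ≠ .lock a) → Traces P t₀ → t' ∈ P.sem u A u' t₀ → Traces P t'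
  | lock (t₀ t₁ t' : Trace N X G M Ex Val) (u : N) (a : M) (u' : N) :
      (u, Action.lock a, u') ∈ P.edges → Traces P t₀ → Traces P t₁ →
      t' ∈ P.semLock u a u' t₀ t₁ → Traces P t'

/-- Traces at whose end the ego thread holds the lockset `S`; `𝒯_S` is the intersection with `𝒯`. -/
def withLocks (S : Set M) : Set (Trace N X G M Ex Val) := {t | P.lockset t t.sink = S}

end Program

/-! ### The constraint system of the local trace semantics -/

/-- Unknowns `[u]` and `[a]`. -/
inductive Unk (N M : Type u) : Type u
  | pt (u : N)
  | mx (a : M)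

@[reducible]
def TraceDom (N X G M Ex Val : Type u) : Unk N M → Type u := fun _ => Set (Trace N X G M Ex Val)

namespace Program

variable (P : Program N X G M Ex Val)

/-- Right-hand sides `⟦u, A⟧`, for the edge `(u, A, u')`. -/
noncomputable def rhs (u : N) (A : Action N X G M Ex) (u' : N)
    (η : ∀ x, TraceDom N X G M Ex Val x) :
    (∀ x, TraceDom N X G M Ex Val x) × Set (Trace N X G M Ex Val) :=
  match A with
  | .create x u₁ => (effect (.pt u₁) (⋃ t ∈ η (.pt u), P.new u₁ t),
      ⋃ t ∈ η (.pt u), P.sem u (.create x u₁) u' t)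
  | .lock a => (⊥, ⋃ t₀ ∈ η (.pt u), ⋃ t₁ ∈ η (.mx a), P.semLock u a u' t₀ t₁)
  | .unlock a => (effect (.mx a) (⋃ t ∈ η (.pt u), P.sem u (.unlock a) u' t),
      ⋃ t ∈ η (.pt u), P.sem u (.unlock a) u' t)
  | .guard r => (⊥, ⋃ t ∈ η (.pt u), P.sem u (.guard r) u' t)
  | .assign x r => (⊥, ⋃ t ∈ η (.pt u), P.sem u (.assign x r) u' t)
  | .read x g => (⊥, ⋃ t ∈ η (.pt u), P.sem u (.read x g) u' t)
  | .write g x => (⊥, ⋃ t ∈ η (.pt u), P.sem u (.write g x) u' t)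

/-- The constraint system `𝒞`; the unknowns `[a]` are initialized to `init`. -/
def traceSystem : Set (SEConstraint (TraceDom N X G M Ex Val)) :=
  {⟨.pt P.start, fun _ => (⊥, P.init)⟩} ∪
  {c | ∃ a : M, c = ⟨.mx a, fun _ => (⊥, P.init)⟩} ∪
  {c | ∃ u A u', (u, A, u') ∈ P.edges ∧ c = ⟨.pt u', P.rhs u A u'⟩}

/-! ### Last thread-local operations -/

variable (t : Trace N X G M Ex Val)

/-- `last_tl_write_g t = (w, g = y, w')`. -/
def IsLastTlWrite (g : G) (w : Node N X Val) (y : X) (w' : Node N X Val) : Prop :=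
  (w, Action.write g y, w') ∈ t.acts ∧ P.tid w' = P.tid t.sink ∧
  ∀ z y' z', (z, Action.write g y', z') ∈ t.acts → P.tid z' = P.tid t.sink → z'.idx ≤ w'.idx

/-- `last_tl_lock_a t = (w, lock(a), w')`. -/
def IsLastTlLock (a : M) (w w' : Node N X Val) : Prop :=
  (w, Action.lock a, w') ∈ t.acts ∧ P.tid w' = P.tid t.sink ∧
  ∀ z z', (z, Action.lock a, z') ∈ t.acts → P.tid z' = P.tid t.sink → z'.idx ≤ w'.idx

end Program

/-! ### Lock-Centered Reading -/

/-- Upward-closed sets of locksets, ordered by inclusion (Mathlib orders `UpperSet` by reverse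
inclusion, hence the order dual). -/
abbrev ULocks (M : Type u) : Type u := (UpperSet (Set M))ᵒᵈ

/-- Triples `(V, L, σ)`. The sets `V a` of definitely written globals are ordered by superset. -/
abbrev State (X G M D : Type u) : Type u :=
  (M → (Set G)ᵒᵈ) × (M → ULocks M) × (X ⊕ G → D)

/-- The element of `ULocks M` represented by the set `{S}` of minimal locksets. -/
def single (S : Set M) : ULocks M := OrderDual.toDual (UpperSet.Ici S)

/-- The abstraction `β t = (V, L, σ)` of a local trace. -/
noncomputable def Program.beta (P : Program N X G M Ex Val) (t : Trace N X G M Ex Val) :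
    State X G M (Set Val) :=
  (fun a => OrderDual.toDual {g | ∃ w y w', P.IsLastTlWrite t g w y w' ∧
      ∀ v v', P.IsLastTlLock t a v v' → t.Le v' w'},
   fun a => OrderDual.toDual
      (upperClosure {B | ∃ v v', P.IsLastTlLock t a v v' ∧ B = P.lockset t v}),
   Sum.elim (fun x => {t.sink.st x})
      (fun g => {d | ∃ w y w', P.IsLastTlWrite t g w y w' ∧ d = w.st y}))

/-- The parameters of the analysis: concretization of abstract values, abstract evaluation of
expressions over locals, abstract guards, and abstract ids `ν♯ u (V, L, σ) u₁` of created threads. -/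
structure Analysis (N X G M Ex Val D : Type u) : Type u where
  conc : D → Set Val
  evalA : Ex → (X → D) → D
  guardA : Ex → (X ⊕ G → D) → (X ⊕ G → D)
  nuA : N → State X G M D → N → D

end

section

variable {N X G M Ex Val D : Type u} [CompleteLattice D]

/-- The concretization `γ_{u,S}`. -/
def gammaPt (P : Program N X G M Ex Val) (𝒜 : Analysis N X G M Ex Val D) (u : N) (S : Set M)
    (s : State X G M D) : Set (Trace N X G M Ex Val) :=
  {t | P.Traces t ∧ t ∈ P.withLocks S ∧ t.sink.pt = u ∧ (P.beta t).1 ≤ s.1 ∧ (P.beta t).2.1 ≤ s.2.1 ∧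
    ∀ z, (P.beta t).2.2 z ⊆ 𝒜.conc (s.2.2 z)}

/-- The concretization `γ_{g,a,S}`. -/
def gammaGl (P : Program N X G M Ex Val) (𝒜 : Analysis N X G M Ex Val D) (g : G) (a : M)
    (S : Set M) (d : D) : Set (Trace N X G M Ex Val) :=
  {t | P.Traces t ∧ t ∈ P.withLocks S ∧ t.LastIs (.unlock a) ∧
      ∃ w y w', P.IsLastTlWrite t g w y w' ∧ w.st y ∈ 𝒜.conc d} ∪
  {t | P.Traces t ∧ t ∈ P.withLocks S ∧ t.LastIs (.unlock a) ∧ ¬ ∃ w y w', P.IsLastTlWrite t g w y w'}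

/-- The basic abstract operations are sound abstractions of their concrete counterparts. -/
structure Analysis.Sound (P : Program N X G M Ex Val) (𝒜 : Analysis N X G M Ex Val D) : Prop where
  conc_mono : Monotone 𝒜.conc
  conc_top : 𝒜.conc ⊤ = Set.univ
  eval : ∀ r (σ : X → Val) (s : X → D), (∀ x, σ x ∈ 𝒜.conc (s x)) →
    P.eval r σ ∈ 𝒜.conc (𝒜.evalA r s)
  guard : ∀ r (σ : X → Val) (ω : G → Set Val) (s : X ⊕ G → D),
    (∀ x, σ x ∈ 𝒜.conc (s (.inl x))) → (∀ g, ω g ⊆ 𝒜.conc (s (.inr g))) →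
    P.eval r σ ≠ P.zero →
    (∀ x, σ x ∈ 𝒜.conc (𝒜.guardA r s (.inl x))) ∧ ∀ g, ω g ⊆ 𝒜.conc (𝒜.guardA r s (.inr g))
  nu : ∀ u x u₁ v S s t, (u, Action.create x u₁, v) ∈ P.edges → t ∈ gammaPt P 𝒜 u S s →
    P.nu t ∈ 𝒜.conc (𝒜.nuA u s u₁)

/-- Unknowns `[u, S]` and `[g, a, S]`. -/
inductive AUnk (N G M : Type u) : Type u
  | pt (u : N) (S : Set M)
  | gl (g : G) (a : M) (S : Set M)

@[reducible]
def ADom (N X G M D : Type u) : AUnk N G M → Type u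
  | .pt _ _ => State X G M D
  | .gl _ _ _ => D

noncomputable instance instCompleteLatticeADom (x : AUnk N G M) :
    CompleteLattice (ADom N X G M D x) :=
  match x with
  | .pt _ _ => inferInstanceAs (CompleteLattice (State X G M D))
  | .gl _ _ _ => inferInstanceAs (CompleteLattice D)

/-- The lockset after an action executed with lockset `S`. -/
def postLocks (A : Action N X G M Ex) (S : Set M) : Set M :=
  match A with
  | .lock a => S ∪ {a}
  | .unlock a => S \ {a}
  | _ => S

/-- The start state `init♯`; it is also used, up to `σ`, for created threads. -/
noncomputable def initState : State X G M D :=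
  (fun _ => OrderDual.toDual ∅, fun _ => OrderDual.toDual (upperClosure ∅),
    Sum.elim (fun _ => ⊤) (fun _ => ⊥))

open Classical in
/-- Right-hand sides `⟦[u,S], A⟧♯` of Lock-Centered Reading. -/
noncomputable def arhs (P : Program N X G M Ex Val) (𝒜 : Analysis N X G M Ex Val D) (u : N)
    (S : Set M) (A : Action N X G M Ex) (η : ∀ x, ADom N X G M D x) :
    (∀ x, ADom N X G M D x) × State X G M D :=
  let V : M → (Set G)ᵒᵈ := (η (.pt u S)).1
  let L : M → ULocks M := (η (.pt u S)).2.1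
  let σ : X ⊕ G → D := (η (.pt u S)).2.2
  match A with
  | .guard r => (⊥, (V, L, 𝒜.guardA r σ))
  | .assign x r => (⊥, (V, L, Function.update σ (.inl x) (𝒜.evalA r fun y => σ (.inl y))))
  | .create x u₁ =>
      let i := 𝒜.nuA u (V, L, σ) u₁
      let σ' : X ⊕ G → D :=
        Sum.elim (Function.update (fun y => σ (.inl y)) P.self i) (fun _ => ⊥)
      (effect (.pt u₁ ∅)
        ((fun _ => OrderDual.toDual ∅, fun _ => OrderDual.toDual (upperClosure ∅), σ') :
          State X G M D),
        (V, L, Function.update σ (.inl x) i))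
  | .lock a => (⊥, (Function.update V a (OrderDual.toDual ∅), Function.update L a (single S), σ))
  | .unlock a =>
      (fun y => match y with
        | .pt _ _ => ⊥
        | .gl g b S' => if b = a ∧ S' = S \ {a} then σ (.inr g) else ⊥,
        (V, L, σ))
  | .write g x =>
      (⊥, (fun a => OrderDual.toDual (OrderDual.ofDual (V a) ∪ {g}), L,
        Function.update σ (.inr g) (σ (.inl x))))
  | .read x g =>
      let d : D := sSup {d | ∃ a S' B, g ∉ OrderDual.ofDual (V a) ∧ B ∈ OrderDual.ofDual (L a) ∧
        B ∩ S' = ∅ ∧ d = η (.gl g a S')}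
      (⊥, (V, L, Function.update σ (.inl x) (σ (.inr g) ⊔ d)))

/-- The constraint system `𝒞₂` of Lock-Centered Reading. -/
def lockCentered (P : Program N X G M Ex Val) (𝒜 : Analysis N X G M Ex Val D) :
    Set (SEConstraint (ADom N X G M D)) :=
  {⟨.pt P.start ∅, fun _ => (⊥, initState)⟩} ∪
  {c | ∃ u A u' S, (u, A, u') ∈ P.edges ∧ c = ⟨.pt u' (postLocks A S), arhs P 𝒜 u S A⟩}

end

end LockCentered

open LockCentered

namespace LockCentered

open Program

variable {N X G M Ex Val : Type u}

/-! ### Causality and program order in global traces -/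

namespace Program.IsGlobalTrace

variable {P : Program N X G M Ex Val} {t : Trace N X G M Ex Val}

/-! The least solution is the inductive family `Reach`, whose constructors mirror the contributions
and side-effects of the concrete system (`isLeast_reach`). Local actions are handled by computing
how one ego step changes the abstraction of a trace (`Extends`). The only non-local question is
where a value read from a global comes from.

`read_origin` answers it. The locking order arranges the critical sections of each mutex in a chain
(`sections_total`). All accesses to `g` lie in sections of `m_g`, so the writes to `g` are linearly
ordered and the read sees the greatest one. Suppose another thread performed it. Consider the
`unlock(a)` ends `f` of that thread, after the write, that causally precede the ego thread's last
acquisition of `a`, over all mutexes `a`; `m_g` provides one. Take the latest such `f`. Let `S'` be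
the lockset at `f` and `B` the one held by the ego thread just before that acquisition. A common
mutex `c` would be released by one thread before the other acquires it: if the writer releases
first, its release is a later candidate than `f`; if the ego thread releases first, causality has a
cycle. Hence `B ∩ S' = ∅`. The ego thread has not written `g` since acquiring `a`, as such a write
would come after the greatest one.

The causal past of `f` is again a trace of the least solution at `[a]` (`Reach.restrict`), because
global subtraces are closed under causal predecessors and determine the past of their nodes. It has
fewer nodes than the trace with the read. Soundness therefore goes by strong induction on the number
of nodes (`sound_of_reach`): the induction hypothesis for this past places the value in `[g,a,S']`,
and the abstract read joins exactly that unknown (`read_value_mem`). -/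

theorem act_facts (h : P.IsGlobalTrace t) {v w : Node N X Val} {A : Action N X G M Ex}
    (e : (v, A, w) ∈ t.acts) :
    v ∈ t.nodes ∧ w ∈ t.nodes ∧ P.tid v = P.tid w ∧ w.idx = v.idx + 1 ∧
      (v.pt, A, w.pt) ∈ P.edges ∧ P.Step A v.st w.st := by
  obtain ⟨I, ρ, -, hρ, hn, ha⟩ := h.raw
  rw [ha] at e
  obtain ⟨i, hi, j, hj, e⟩ := e
  simp only [Prod.mk.injEq] at e
  obtain ⟨rfl, rfl, rfl⟩ := e
  rw [hn]
  refine ⟨⟨i, hi, j, hj.le, rfl⟩, ⟨i, hi, j + 1, hj, rfl⟩, ?_, rfl, ((hρ i hi).2 j hj).1,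
    ((hρ i hi).2 j hj).2⟩
  exact ((hρ i hi).1 j hj.le).trans ((hρ i hi).1 (j + 1) hj).symm

theorem source_mem (h : P.IsGlobalTrace t) {v w : Node N X Val} {A : Action N X G M Ex}
    (e : (v, A, w) ∈ t.acts) : v ∈ t.nodes := (h.act_facts e).1

theorem target_mem (h : P.IsGlobalTrace t) {v w : Node N X Val} {A : Action N X G M Ex}
    (e : (v, A, w) ∈ t.acts) : w ∈ t.nodes := (h.act_facts e).2.1

theorem tid_eq (h : P.IsGlobalTrace t) {v w : Node N X Val} {A : Action N X G M Ex}
    (e : (v, A, w) ∈ t.acts) : P.tid v = P.tid w := (h.act_facts e).2.2.1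

theorem idx_eq (h : P.IsGlobalTrace t) {v w : Node N X Val} {A : Action N X G M Ex}
    (e : (v, A, w) ∈ t.acts) : w.idx = v.idx + 1 := (h.act_facts e).2.2.2.1

theorem edge_mem (h : P.IsGlobalTrace t) {v w : Node N X Val} {A : Action N X G M Ex}
    (e : (v, A, w) ∈ t.acts) : (v.pt, A, w.pt) ∈ P.edges := (h.act_facts e).2.2.2.2.1

/-- Nodes are determined by their thread and their position in it. -/
theorem node_eq (h : P.IsGlobalTrace t) {v w : Node N X Val} (hv : v ∈ t.nodes)
    (hw : w ∈ t.nodes) (hid : P.tid v = P.tid w) (hidx : v.idx = w.idx) : v = w := by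
  obtain ⟨I, ρ, -, hρ, hn, -⟩ := h.raw
  rw [hn] at hv hw
  obtain ⟨i, hi, j, hj, rfl⟩ := hv
  obtain ⟨i', hi', j', hj', rfl⟩ := hw
  have h1 : P.tid ((ρ i).node j) = i := (hρ i hi).1 j hj
  have h2 : P.tid ((ρ i').node j') = i' := (hρ i' hi').1 j' hj'
  rw [h1, h2] at hid
  subst hid
  change j = j' at hidx
  subst hidx
  rfl

/-- The runs are indexed by thread id, so id and position of the source single out one run and one
edge in it. -/
theorem act_eq_of_target (h : P.IsGlobalTrace t) {v w v' : Node N X Val}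
    {A A' : Action N X G M Ex} (e : (v, A, w) ∈ t.acts) (e' : (v', A', w) ∈ t.acts) :
    v = v' ∧ A = A' := by
  have hv : v = v' := h.node_eq (h.source_mem e) (h.source_mem e')
    ((h.tid_eq e).trans (h.tid_eq e').symm) (by have := h.idx_eq e; have := h.idx_eq e'; omega)
  refine ⟨hv, ?_⟩
  obtain ⟨I, ρ, -, hρ, hn, ha⟩ := h.raw
  rw [ha] at e e'
  obtain ⟨i, hi, j, hj, e⟩ := e
  obtain ⟨i', hi', j', hj', e'⟩ := e'
  simp only [Prod.mk.injEq] at e e'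
  obtain ⟨rfl, rfl, rfl⟩ := e
  obtain ⟨rfl, rfl, e'⟩ := e'
  have h1 : P.tid ((ρ i).node j) = i := (hρ i hi).1 j hj.le
  have h2 : P.tid ((ρ i').node j') = i' := (hρ i' hi').1 j' hj'.le
  have hid := congrArg P.tid hv
  rw [h1, h2] at hid
  subst hid
  have hidx : j = j' := congrArg Node.idx hv
  subst hidx
  rfl

theorem act_eq_of_source (h : P.IsGlobalTrace t) {v w w' : Node N X Val}
    {A A' : Action N X G M Ex} (e : (v, A, w) ∈ t.acts) (e' : (v, A', w') ∈ t.acts) :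
    w = w' ∧ A = A' := by
  have hw : w = w' := h.node_eq (h.target_mem e) (h.target_mem e')
    ((h.tid_eq e).symm.trans (h.tid_eq e')) (by rw [h.idx_eq e, h.idx_eq e'])
  subst hw
  have hA := h.act_eq_of_target e e'
  exact ⟨rfl, hA.right⟩

/-- Every node at a positive position is the end of a program-order edge. -/
theorem exists_act_to (h : P.IsGlobalTrace t) {w : Node N X Val} (hw : w ∈ t.nodes)
    (hpos : w.idx ≠ 0) : ∃ v A, (v, A, w) ∈ t.acts := by
  obtain ⟨I, ρ, -, hρ, hn, ha⟩ := h.raw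
  rw [hn] at hw
  obtain ⟨i, hi, j, hj, rfl⟩ := hw
  change j ≠ 0 at hpos
  obtain ⟨k, rfl⟩ := Nat.exists_eq_succ_of_ne_zero hpos
  exact ⟨(ρ i).node k, (ρ i).act k, by rw [ha]; exact ⟨i, hi, k, hj, rfl⟩⟩

theorem imm_mem (h : P.IsGlobalTrace t) {v w : Node N X Val} (hi : t.Imm v w) :
    v ∈ t.nodes ∧ w ∈ t.nodes := by
  rcases hi with ⟨A, e⟩ | hc | ⟨a, hl⟩
  · exact ⟨h.source_mem e, h.target_mem e⟩
  · exact ⟨(h.cr_dom _ _ hc).1, (h.cr_dom _ _ hc).2.1⟩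
  · obtain ⟨h1, -, w', h2⟩ := h.lk_dom _ _ _ hl
    exact ⟨h1, h.target_mem h2⟩

theorem mem_of_le (h : P.IsGlobalTrace t) {v w : Node N X Val} (hl : t.Le v w)
    (hw : w ∈ t.nodes) : v ∈ t.nodes := by
  rcases Relation.ReflTransGen.cases_head hl with rfl | ⟨c, hc, -⟩
  · exact hw
  · exact (h.imm_mem hc).1

theorem act_le {v w : Node N X Val} {A : Action N X G M Ex}
    (e : (v, A, w) ∈ t.acts) : t.Le v w := .single (.inl ⟨A, e⟩)

theorem lk_le {a : M} {v w : Node N X Val} (e : t.lk a v w) : t.Le v w :=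
  .single (.inr (.inr ⟨a, e⟩))

theorem le_antisymm (h : P.IsGlobalTrace t) {v w : Node N X Val} (h1 : t.Le v w)
    (h2 : t.Le w v) : v = w := by
  rcases Relation.reflTransGen_iff_eq_or_transGen.1 h1 with e | h3
  · exact e.symm
  · exact absurd (h3.trans_left h2) (h.acyclic v)

/-- Within a thread, earlier nodes are present and causally before later ones. -/
theorem exists_earlier (h : P.IsGlobalTrace t) {w : Node N X Val} (hw : w ∈ t.nodes) (k : ℕ)
    (hk : k ≤ w.idx) : ∃ v ∈ t.nodes, P.tid v = P.tid w ∧ v.idx = k ∧ t.Le v w := by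
  obtain ⟨d, hd⟩ := Nat.exists_eq_add_of_le hk
  induction d generalizing w with
  | zero => exact ⟨w, hw, rfl, by omega, .refl⟩
  | succ d ih =>
    obtain ⟨v, A, e⟩ := h.exists_act_to hw (by omega)
    have := h.idx_eq e
    obtain ⟨z, hz, h1, h2, h3⟩ := ih (h.source_mem e) (by omega) (by omega)
    exact ⟨z, hz, h1.trans (h.tid_eq e), h2, h3.trans (act_le e)⟩

theorem le_of_idx_le (h : P.IsGlobalTrace t) {v w : Node N X Val} (hv : v ∈ t.nodes)
    (hw : w ∈ t.nodes) (hid : P.tid v = P.tid w) (hidx : v.idx ≤ w.idx) : t.Le v w := by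
  obtain ⟨z, hz, h1, h2, h3⟩ := h.exists_earlier hw _ hidx
  rwa [h.node_eq hv hz (hid.trans h1.symm) h2.symm]

theorem idx_le_of_le (h : P.IsGlobalTrace t) {v w : Node N X Val} (hv : v ∈ t.nodes)
    (hw : w ∈ t.nodes) (hid : P.tid v = P.tid w) (hl : t.Le v w) : v.idx ≤ w.idx := by
  by_contra hc
  have := h.le_antisymm hl (h.le_of_idx_le hw hv hid.symm (by omega))
  subst this
  exact hc le_rfl

theorem root_eq (h : P.IsGlobalTrace t) {r r' : Node N X Val} (hr : r ∈ t.nodes)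
    (hr' : r' ∈ t.nodes) (h1 : P.IsRoot r) (h2 : P.IsRoot r') : r = r' :=
  h.node_eq hr hr' (h1.2.2.trans h2.2.2.symm) (h1.1.trans h2.1.symm)

end Program.IsGlobalTrace

theorem Program.IsLocalTrace.idx_le_sink {P : Program N X G M Ex Val} {t : Trace N X G M Ex Val}
    (h : P.IsLocalTrace t) {v : Node N X Val} (hv : v ∈ t.nodes) (hid : P.tid v = P.tid t.sink) :
    v.idx ≤ t.sink.idx :=
  h.idx_le_of_le hv h.sink_mem hid (h.sink_max v hv)

/-! ### Subtraces -/

/-- The graph of `s` is contained in the graph of `t`. -/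
structure Trace.Sub (s t : Trace N X G M Ex Val) : Prop where
  nodes : s.nodes ⊆ t.nodes
  acts : s.acts ⊆ t.acts
  cr : ∀ v w, s.cr v w → t.cr v w
  lk : ∀ a v w, s.lk a v w → t.lk a v w

namespace Trace.Sub

variable {P : Program N X G M Ex Val} {s t : Trace N X G M Ex Val}

theorem imm (h : s.Sub t) {v w : Node N X Val} (hi : s.Imm v w) : t.Imm v w := by
  rcases hi with ⟨A, e⟩ | hc | ⟨a, hl⟩
  · exact .inl ⟨A, h.acts e⟩
  · exact .inr (.inl (h.cr _ _ hc))
  · exact .inr (.inr ⟨a, h.lk _ _ _ hl⟩)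

theorem le (h : s.Sub t) {v w : Node N X Val} (hl : s.Le v w) : t.Le v w :=
  Relation.ReflTransGen.mono (fun _ _ => h.imm) _ _ hl

/-- Since `s` is itself a global trace, its node `w`, being at a positive position, already has an
incoming program edge in `s`; uniqueness in `t` identifies the two edges. `cr_of` and `lk_of` use
the same existence-against-uniqueness argument, and together they make subtraces closed under causal
predecessors. -/
theorem act_mem (h : s.Sub t) (hs : P.IsGlobalTrace s) (ht : P.IsGlobalTrace t)
    {v w : Node N X Val} {A : Action N X G M Ex} (e : (v, A, w) ∈ t.acts) (hw : w ∈ s.nodes) :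
    (v, A, w) ∈ s.acts := by
  obtain ⟨v', A', e'⟩ := hs.exists_act_to hw (by have := ht.idx_eq e; omega)
  obtain ⟨rfl, rfl⟩ := ht.act_eq_of_target e (h.acts e')
  exact e'

theorem cr_of (h : s.Sub t) (hs : P.IsGlobalTrace s) (ht : P.IsGlobalTrace t)
    {v w : Node N X Val} (e : t.cr v w) (hw : w ∈ s.nodes) : s.cr v w := by
  obtain ⟨-, hwt, h0, hr, -⟩ := ht.cr_dom _ _ e
  obtain ⟨z, hz, -⟩ := hs.cr_pred w hw h0 hr
  rwa [(ht.cr_pred w hwt h0 hr).unique e (h.cr _ _ hz)]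

theorem lk_of (h : s.Sub t) (hs : P.IsGlobalTrace s) (ht : P.IsGlobalTrace t) {a : M}
    {v w : Node N X Val} (e : t.lk a v w) (hw : w ∈ s.nodes) : s.lk a v w := by
  obtain ⟨-, -, z, hz⟩ := ht.lk_dom _ _ _ e
  obtain ⟨z', hz', -⟩ := hs.lk_pred a z w (h.act_mem hs ht hz hw)
  rwa [(ht.lk_pred a z w hz).unique e (h.lk _ _ _ hz')]

theorem imm_of (h : s.Sub t) (hs : P.IsGlobalTrace s) (ht : P.IsGlobalTrace t)
    {v w : Node N X Val} (hi : t.Imm v w) (hw : w ∈ s.nodes) : s.Imm v w := by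
  rcases hi with ⟨A, e⟩ | hc | ⟨a, hl⟩
  · exact .inl ⟨A, h.act_mem hs ht e hw⟩
  · exact .inr (.inl (h.cr_of hs ht hc hw))
  · exact .inr (.inr ⟨a, h.lk_of hs ht hl hw⟩)

/-- Subtraces are closed under causal predecessors. -/
theorem le_iff (h : s.Sub t) (hs : P.IsGlobalTrace s) (ht : P.IsGlobalTrace t)
    {v w : Node N X Val} (hw : w ∈ s.nodes) : t.Le v w ↔ s.Le v w := by
  refine ⟨fun hl => ?_, h.le⟩
  induction hl using Relation.ReflTransGen.head_induction_on with
  | refl => exact .refl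
  | head hi _ ih => exact (Relation.ReflTransGen.single
      (h.imm_of hs ht hi (hs.mem_of_le ih hw))).trans ih

/-- A node of `t` preceding a node of `s` in the same thread belongs to `s`. -/
theorem mem_of_idx_le (h : s.Sub t) (hs : P.IsGlobalTrace s) (ht : P.IsGlobalTrace t)
    {v w : Node N X Val} (hv : v ∈ t.nodes) (hw : w ∈ s.nodes) (hid : P.tid v = P.tid w)
    (hidx : v.idx ≤ w.idx) : v ∈ s.nodes :=
  hs.mem_of_le ((h.le_iff hs ht hw).1 (ht.le_of_idx_le hv (h.nodes hw) hid hidx)) hw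

/-- A lockset depends only on earlier edges of the same thread, which both graphs share. -/
theorem lockset_eq (h : s.Sub t) (hs : P.IsGlobalTrace s) (ht : P.IsGlobalTrace t)
    {v : Node N X Val} (hv : v ∈ s.nodes) : P.lockset t v = P.lockset s v := by
  have key : ∀ z A z', P.tid z' = P.tid v → z'.idx ≤ v.idx →
      ((z, A, z') ∈ t.acts ↔ (z, A, z') ∈ s.acts) := fun z A z' h1 h2 =>
    ⟨fun e => h.act_mem hs ht e (h.mem_of_idx_le hs ht (ht.target_mem e) hv h1 h2),
      fun e => h.acts e⟩
  ext a
  constructor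
  · rintro ⟨w, w', e, h1, h2, h3⟩
    exact ⟨w, w', (key _ _ _ h1 h2).1 e, h1, h2, fun z z' e' => h3 z z' (h.acts e')⟩
  · rintro ⟨w, w', e, h1, h2, h3⟩
    exact ⟨w, w', h.acts e, h1, h2, fun z z' e' h4 h5 => h3 z z' ((key _ _ _ h4 h5).1 e') h4 h5⟩

end Trace.Sub

/-- The causal past of the node `v` in `t`. -/
def Trace.restrict (t : Trace N X G M Ex Val) (v : Node N X Val) : Trace N X G M Ex Val where
  nodes := {w | w ∈ t.nodes ∧ t.Le w v}
  acts := {e | e ∈ t.acts ∧ t.Le e.2.2 v}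
  cr w w' := t.cr w w' ∧ t.Le w' v
  lk a w w' := t.lk a w w' ∧ t.Le w' v
  sink := v

theorem Trace.restrict_sub (t : Trace N X G M Ex Val) (v : Node N X Val) :
    (t.restrict v).Sub t :=
  ⟨fun _ h => h.1, fun _ h => h.1, fun _ _ h => h.1, fun _ _ _ h => h.1⟩

theorem Trace.restrict_sink {P : Program N X G M Ex Val} {t : Trace N X G M Ex Val}
    (h : P.IsLocalTrace t) : t.restrict t.sink = t := by
  ext1
  · ext w; exact ⟨fun h => h.1, fun hw => ⟨hw, h.sink_max _ hw⟩⟩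
  · ext ⟨v, A, w⟩; exact ⟨fun h => h.1, fun e => ⟨e, h.sink_max _ (h.target_mem e)⟩⟩
  · ext v w; exact ⟨fun h => h.1, fun e => ⟨e, h.sink_max _ (h.cr_dom _ _ e).2.1⟩⟩
  · ext a v w
    refine ⟨fun h => h.1, fun e => ⟨e, h.sink_max _ ?_⟩⟩
    exact (h.imm_mem (.inr (.inr ⟨a, e⟩))).2
  · rfl

/-- Causal pasts survive extension of the trace. This lets the operations of the semantics inherit
statements about pasts from their arguments. -/
theorem Trace.Sub.restrict_eq {P : Program N X G M Ex Val} {s t : Trace N X G M Ex Val}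
    (h : s.Sub t) (hs : P.IsGlobalTrace s) (ht : P.IsGlobalTrace t) {v : Node N X Val}
    (hv : v ∈ s.nodes) : t.restrict v = s.restrict v := by
  have key : ∀ w, t.Le w v ↔ s.Le w v := fun w => h.le_iff hs ht hv
  have mem : ∀ w, s.Le w v → w ∈ s.nodes := fun w hw => hs.mem_of_le hw hv
  ext1
  · ext w
    exact ⟨fun ⟨_, h2⟩ => ⟨mem _ ((key w).1 h2), (key w).1 h2⟩,
      fun ⟨h1, h2⟩ => ⟨h.nodes h1, (key w).2 h2⟩⟩
  · ext ⟨z, A, w⟩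
    exact ⟨fun ⟨h1, h2⟩ => ⟨h.act_mem hs ht h1 (mem _ ((key w).1 h2)), (key w).1 h2⟩,
      fun ⟨h1, h2⟩ => ⟨h.acts h1, (key w).2 h2⟩⟩
  · ext z w
    exact ⟨fun ⟨h1, h2⟩ => ⟨h.cr_of hs ht h1 (mem _ ((key w).1 h2)), (key w).1 h2⟩,
      fun ⟨h1, h2⟩ => ⟨h.cr _ _ h1, (key w).2 h2⟩⟩
  · ext a z w
    exact ⟨fun ⟨h1, h2⟩ => ⟨h.lk_of hs ht h1 (mem _ ((key w).1 h2)), (key w).1 h2⟩,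
      fun ⟨h1, h2⟩ => ⟨h.lk _ _ _ h1, (key w).2 h2⟩⟩
  · rfl

/-! ### The least solution of the concrete system -/

/-- The components of the least solution of the concrete constraint system, as an inductive
predicate. -/
inductive Reach (P : Program N X G M Ex Val) : Unk N M → Trace N X G M Ex Val → Prop
  | init_pt (t : Trace N X G M Ex Val) : t ∈ P.init → Reach P (.pt P.start) t
  | init_mx (a : M) (t : Trace N X G M Ex Val) : t ∈ P.init → Reach P (.mx a) t
  | new (u : N) (x : X) (u₁ u' : N) (t₀ t : Trace N X G M Ex Val) :
      (u, Action.create x u₁, u') ∈ P.edges → Reach P (.pt u) t₀ → t ∈ P.new u₁ t₀ →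
      Reach P (.pt u₁) t
  | edge (u : N) (A : Action N X G M Ex) (u' : N) (t₀ t : Trace N X G M Ex Val) :
      (u, A, u') ∈ P.edges → (∀ a, A ≠ .lock a) → Reach P (.pt u) t₀ → t ∈ P.sem u A u' t₀ →
      Reach P (.pt u') t
  | unlock_mx (u : N) (a : M) (u' : N) (t₀ t : Trace N X G M Ex Val) :
      (u, Action.unlock a, u') ∈ P.edges → Reach P (.pt u) t₀ →
      t ∈ P.sem u (.unlock a) u' t₀ → Reach P (.mx a) t
  | lock (u : N) (a : M) (u' : N) (t₀ t₁ t : Trace N X G M Ex Val) :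
      (u, Action.lock a, u') ∈ P.edges → Reach P (.pt u) t₀ → Reach P (.mx a) t₁ →
      t ∈ P.semLock u a u' t₀ t₁ → Reach P (.pt u') t

theorem effect_le_iff {Un : Type u} {Dom : Un → Type u} [∀ x, CompleteLattice (Dom x)]
    (x : Un) (d : Dom x) (η : ∀ x, Dom x) : effect x d ≤ η ↔ d ≤ η x := by
  classical
  unfold effect
  rw [update_le_iff]
  exact ⟨fun h => h.1, fun h => ⟨h, fun _ _ => bot_le⟩⟩

theorem isLeast_reach (P : Program N X G M Ex Val) :
    IsLeast {η | IsPostSolution P.traceSystem η} (fun x => {t | Reach P x t}) := by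
  constructor
  · rintro c ((rfl | ⟨a, rfl⟩) | ⟨u, A, u', he, rfl⟩)
    · exact ⟨bot_le, fun t ht => .init_pt t ht⟩
    · exact ⟨bot_le, fun t ht => .init_mx a t ht⟩
    · cases A with
      | create x u₁ =>
        refine ⟨(effect_le_iff _ _ _).2 ?_, ?_⟩
        · exact Set.iUnion₂_subset fun t₀ h₀ t ht => .new u x u₁ u' t₀ t he h₀ ht
        · exact Set.iUnion₂_subset fun t₀ h₀ t ht => .edge u _ u' t₀ t he (by simp) h₀ ht
      | lock a =>
        refine ⟨bot_le, ?_⟩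
        exact Set.iUnion₂_subset fun t₀ h₀ => Set.iUnion₂_subset fun t₁ h₁ t ht =>
          .lock u a u' t₀ t₁ t he h₀ h₁ ht
      | unlock a =>
        refine ⟨(effect_le_iff _ _ _).2 ?_, ?_⟩
        · exact Set.iUnion₂_subset fun t₀ h₀ t ht => .unlock_mx u a u' t₀ t he h₀ ht
        · exact Set.iUnion₂_subset fun t₀ h₀ t ht => .edge u _ u' t₀ t he (by simp) h₀ ht
      | _ =>
        exact ⟨bot_le, Set.iUnion₂_subset fun t₀ h₀ t ht => .edge u _ u' t₀ t he (by simp) h₀ ht⟩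
  · intro η hη x t ht
    have sys : ∀ u A u', (u, A, u') ∈ P.edges →
        (P.rhs u A u' η).1 ≤ η ∧ (P.rhs u A u' η).2 ≤ η (.pt u') := fun u A u' he =>
      hη ⟨.pt u', P.rhs u A u'⟩ (.inr ⟨u, A, u', he, rfl⟩)
    change Reach P x t at ht
    induction ht with
    | init_pt t ht => exact (hη _ (.inl (.inl rfl))).2 ht
    | init_mx a t ht => exact (hη ⟨.mx a, fun _ => (⊥, P.init)⟩ (.inl (.inr ⟨a, rfl⟩))).2 ht
    | new u x u₁ u' t₀ t he _ ht ih =>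
      exact (effect_le_iff _ _ _).1 (sys _ _ _ he).1 (Set.mem_iUnion₂_of_mem ih ht)
    | edge u A u' t₀ t he hA _ ht ih =>
      cases A with
      | lock a => exact absurd rfl (hA a)
      | _ => exact (sys _ _ _ he).2 (Set.mem_iUnion₂_of_mem ih ht)
    | unlock_mx u a u' t₀ t he _ ht ih =>
      exact (effect_le_iff _ _ _).1 (sys _ _ _ he).1 (Set.mem_iUnion₂_of_mem ih ht)
    | lock u a u' t₀ t₁ t he _ _ ht ih₀ ih₁ =>
      exact (sys _ _ _ he).2 (Set.mem_iUnion₂_of_mem ih₀ (Set.mem_iUnion₂_of_mem ih₁ ht))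

/-! ### Well-formedness and finiteness of the traces of the least solution -/

theorem isLocalTrace_initTrace (P : Program N X G M Ex Val) {σ : X → Val}
    (hσ : σ P.self = P.tid0) : P.IsLocalTrace (P.initTrace σ) := by
  have himm : ∀ v w, ¬ (P.initTrace σ).Imm v w := by
    rintro v w (⟨A, e⟩ | hc | ⟨a, hl⟩)
    · exact e
    · exact hc
    · exact hl
  refine ⟨⟨?_, ?_, ?_, ?_, ?_, ?_, ?_, ?_, ?_, ?_, ?_, ?_⟩, rfl, ?_⟩
  -- The run has length 0, so the action supplied is an irrelevant filler.
  · refine ⟨{P.tid0}, fun _ => ⟨0, fun _ => P.start, fun _ => σ,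
      fun _ => .create P.self P.start⟩, ?_, ?_, ?_, ?_⟩
    · rintro _ rfl; exact P.tid0_mem
    · rintro _ rfl; exact ⟨fun _ _ => hσ, fun j hj => absurd hj (Nat.not_lt_zero j)⟩
    · ext v
      constructor
      · rintro rfl; exact ⟨_, rfl, 0, le_rfl, rfl⟩
      · rintro ⟨_, rfl, j, hj, rfl⟩
        obtain rfl : j = 0 := Nat.le_zero.1 hj
        rfl
    · ext e
      constructor
      · exact fun h => h.elim
      · rintro ⟨_, _, j, hj, _⟩; exact absurd hj (Nat.not_lt_zero j)
  · intro v hv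
    obtain ⟨w, hw, -⟩ := Relation.TransGen.head'_iff.1 hv
    exact himm _ _ hw
  · refine ⟨⟨0, P.start, σ⟩, rfl, ⟨rfl, rfl, hσ⟩, ?_⟩
    rintro _ rfl; exact .refl
  · exact fun _ _ h => h.elim
  · rintro _ rfl _ h; exact absurd ⟨rfl, rfl, hσ⟩ h
  · exact fun _ _ _ h => h.elim
  · exact fun _ _ _ h => h.elim
  · exact fun _ _ _ _ h => h.elim
  · exact fun _ _ _ h => h.elim
  · exact fun _ _ _ h => h.elim
  · exact fun _ _ _ h => h.elim
  · exact fun _ _ _ _ h => h.elim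
  · rintro _ rfl; exact .refl

theorem Reach.isLocalTrace {P : Program N X G M Ex Val} {x : Unk N M} {t : Trace N X G M Ex Val}
    (h : Reach P x t) : P.IsLocalTrace t := by
  cases h with
  | init_pt _ h => obtain ⟨σ, hσ, rfl⟩ := h; exact isLocalTrace_initTrace P hσ
  | init_mx _ _ h => obtain ⟨σ, hσ, rfl⟩ := h; exact isLocalTrace_initTrace P hσ
  | new _ _ _ _ _ _ _ _ h => exact h.1
  | edge _ _ _ _ _ _ _ _ h => exact h.1
  | unlock_mx _ _ _ _ _ _ _ h => exact h.1
  | lock _ _ _ _ _ _ _ _ _ h => exact h.1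

theorem Reach.traces {P : Program N X G M Ex Val} {x : Unk N M} {t : Trace N X G M Ex Val}
    (h : Reach P x t) : P.Traces t := by
  induction h with
  | init_pt t h => exact .init t h
  | init_mx _ t h => exact .init t h
  | new u x u₁ u' t₀ t _ _ h ih => exact .new t₀ t u₁ ih h
  | edge u A u' t₀ t he hA _ h ih => exact .edge t₀ t u A u' he hA ih h
  | unlock_mx u a u' t₀ t he _ h ih => exact .edge t₀ t u _ u' he (by simp) ih h
  | lock u a u' t₀ t₁ t he _ _ h ih₀ ih₁ => exact .lock t₀ t₁ t u a u' he ih₀ ih₁ h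

/-- Global traces may have infinitely many threads; finiteness comes from the finitely many
operations that build a trace. It is needed for numbering critical sections, for choosing latest
nodes and for the final induction. -/
theorem Reach.finite_nodes {P : Program N X G M Ex Val} {x : Unk N M}
    {t : Trace N X G M Ex Val} (h : Reach P x t) : t.nodes.Finite := by
  induction h with
  | init_pt t h => obtain ⟨σ, _, rfl⟩ := h; exact Set.finite_singleton _
  | init_mx _ t h => obtain ⟨σ, _, rfl⟩ := h; exact Set.finite_singleton _
  | new u x u₁ u' t₀ t _ _ h ih => rw [h.2.2.1]; exact ih.insert _
  | edge u A u' t₀ t he hA _ h ih => rw [h.2.2.2.2.2.2.1]; exact ih.insert _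
  | unlock_mx u a u' t₀ t he _ h ih => rw [h.2.2.2.2.2.2.1]; exact ih.insert _
  | lock u a u' t₀ t₁ t he _ _ h ih₀ ih₁ => rw [h.2.2.2.2.1]; exact (ih₀.union ih₁).insert _

/-! ### The operations only enlarge their arguments -/

theorem sub_of_mem_new {P : Program N X G M Ex Val} {u₁ : N} {t₀ t : Trace N X G M Ex Val}
    (h : t ∈ P.new u₁ t₀) : t₀.Sub t := by
  obtain ⟨-, -, hn, ha, hc, hl⟩ := h
  exact ⟨hn ▸ Set.subset_insert _ _, ha.ge, fun v w e => (hc v w).2 (.inl e),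
    fun a v w e => hl ▸ e⟩

theorem sub_of_mem_sem {P : Program N X G M Ex Val} {u u' : N} {A : Action N X G M Ex}
    {t₀ t : Trace N X G M Ex Val} (h : t ∈ P.sem u A u' t₀) : t₀.Sub t := by
  obtain ⟨-, -, -, -, -, -, hn, ha, hc, hl⟩ := h
  exact ⟨hn ▸ Set.subset_insert _ _, ha ▸ Set.subset_insert _ _, fun v w e => hc ▸ e,
    fun a v w e => hl ▸ e⟩

theorem sub_left_of_mem_semLock {P : Program N X G M Ex Val} {u u' : N} {a : M}
    {t₀ t₁ t : Trace N X G M Ex Val} (h : t ∈ P.semLock u a u' t₀ t₁) : t₀.Sub t := by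
  obtain ⟨-, -, -, -, hn, ha, hc, hl⟩ := h
  exact ⟨hn ▸ Set.subset_union_left.trans (Set.subset_insert _ _),
    ha ▸ Set.subset_union_left.trans (Set.subset_insert _ _),
    fun v w e => (hc v w).2 (.inl e), fun b v w e => (hl b v w).2 (.inl e)⟩

theorem sub_right_of_mem_semLock {P : Program N X G M Ex Val} {u u' : N} {a : M}
    {t₀ t₁ t : Trace N X G M Ex Val} (h : t ∈ P.semLock u a u' t₀ t₁) : t₁.Sub t := by
  obtain ⟨-, -, -, -, hn, ha, hc, hl⟩ := h
  exact ⟨hn ▸ Set.subset_union_right.trans (Set.subset_insert _ _),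
    ha ▸ Set.subset_union_right.trans (Set.subset_insert _ _),
    fun v w e => (hc v w).2 (.inr e), fun b v w e => (hl b v w).2 (.inr (.inl e))⟩

/-- The causal past of every node of a trace of the least solution belongs to the least solution. -/
theorem Reach.restrict {P : Program N X G M Ex Val} {x : Unk N M} {t : Trace N X G M Ex Val}
    (h : Reach P x t) : ∀ v ∈ t.nodes, Reach P (.pt v.pt) (t.restrict v) ∧
      ∀ w a, (w, Action.unlock a, v) ∈ t.acts → Reach P (.mx a) (t.restrict v) := by
  -- Old nodes keep their causal past, so only the new sink needs an argument; its past is the whole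
  -- trace.
  have pass : ∀ (s t : Trace N X G M Ex Val), s.Sub t → P.IsLocalTrace s → P.IsLocalTrace t →
      (∀ v ∈ s.nodes, Reach P (.pt v.pt) (s.restrict v) ∧
        ∀ w a, (w, Action.unlock a, v) ∈ s.acts → Reach P (.mx a) (s.restrict v)) →
      ∀ v ∈ s.nodes, Reach P (.pt v.pt) (t.restrict v) ∧
        ∀ w a, (w, Action.unlock a, v) ∈ t.acts → Reach P (.mx a) (t.restrict v) := by
    intro s t hst hs ht ih v hv
    rw [hst.restrict_eq hs.toIsGlobalTrace ht.toIsGlobalTrace hv]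
    exact ⟨(ih v hv).1, fun w a e => (ih v hv).2 w a
      (hst.act_mem hs.toIsGlobalTrace ht.toIsGlobalTrace e hv)⟩
  have hinit : ∀ t ∈ P.init, ∀ v ∈ t.nodes, Reach P (.pt v.pt) (t.restrict v) ∧
      ∀ w a, (w, Action.unlock a, v) ∈ t.acts → Reach P (.mx a) (t.restrict v) := by
    rintro _ ⟨σ, hσ, rfl⟩ v rfl
    have e := Trace.restrict_sink (isLocalTrace_initTrace P hσ)
    refine ⟨?_, fun _ _ h => h.elim⟩
    exact e.symm ▸ .init_pt _ ⟨σ, hσ, rfl⟩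
  have hedge : ∀ u A u' t₀ t, (u, A, u') ∈ P.edges → (∀ a, A ≠ .lock a) → Reach P (.pt u) t₀ →
      t ∈ P.sem u A u' t₀ →
      (∀ v ∈ t₀.nodes, Reach P (.pt v.pt) (t₀.restrict v) ∧
        ∀ w a, (w, Action.unlock a, v) ∈ t₀.acts → Reach P (.mx a) (t₀.restrict v)) →
      ∀ v ∈ t.nodes, Reach P (.pt v.pt) (t.restrict v) ∧
        ∀ w a, (w, Action.unlock a, v) ∈ t.acts → Reach P (.mx a) (t.restrict v) := by
    intro u A u' t₀ t he hA h₀ ht ih v hv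
    have hl := ht.1
    have hv' := hv
    rw [ht.2.2.2.2.2.2.1] at hv'
    rcases hv' with rfl | hv'
    · rw [Trace.restrict_sink hl]
      refine ⟨ht.2.2.2.1 ▸ .edge u A u' t₀ t he hA h₀ ht, fun w a e => ?_⟩
      have e' : (t₀.sink, A, t.sink) ∈ t.acts := by
        rw [ht.2.2.2.2.2.2.2.1]; exact Set.mem_insert _ _
      obtain ⟨-, rfl⟩ := hl.act_eq_of_target e e'
      exact .unlock_mx u a u' t₀ t he h₀ ht
    · exact pass t₀ t (sub_of_mem_sem ht) h₀.isLocalTrace hl ih v hv'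
  induction h with
  | init_pt t h => exact hinit t h
  | init_mx _ t h => exact hinit t h
  | new u x u₁ u' t₀ t he h₀ ht ih =>
    intro v hv
    have hl := ht.1
    have hv' := hv
    rw [ht.2.2.1] at hv'
    rcases hv' with rfl | hv'
    · rw [Trace.restrict_sink hl]
      have hs := ht.2.1
      refine ⟨?_, fun w a e => ?_⟩
      · rw [hs]; exact .new u x u₁ u' t₀ t he h₀ ht
      -- The sink is the first node of the new thread, at position 0, so no `unlock` edge ends
      -- there.
      · have := hl.idx_eq e
        rw [hs] at this
        simp at this
    · exact pass t₀ t (sub_of_mem_new ht) h₀.isLocalTrace hl ih v hv'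
  | edge u A u' t₀ t he hA h₀ h ih => exact hedge u A u' t₀ t he hA h₀ h ih
  | unlock_mx u a u' t₀ t he h₀ h ih => exact hedge u _ u' t₀ t he (by simp) h₀ h ih
  | lock u a u' t₀ t₁ t he h₀ h₁ ht ih₀ ih₁ =>
    intro v hv
    have hl := ht.1
    have hv' := hv
    rw [ht.2.2.2.2.1] at hv'
    rcases hv' with rfl | hv' | hv'
    · rw [Trace.restrict_sink hl]
      have hs := ht.2.2.2.1
      refine ⟨?_, fun w b e => ?_⟩
      · rw [hs]; exact .lock u a u' t₀ t₁ t he h₀ h₁ ht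
      · have e' : (t₀.sink, .lock a, t.sink) ∈ t.acts := by
          rw [ht.2.2.2.2.2.1]; exact Set.mem_insert _ _
        exact absurd (hl.act_eq_of_target e e').2 (by simp)
    · exact pass t₀ t (sub_left_of_mem_semLock ht) h₀.isLocalTrace hl ih₀ v hv'
    · have hr := sub_right_of_mem_semLock ht
      exact pass t₁ t hr h₁.isLocalTrace hl ih₁ v ‹v ∈ t₁.nodes›

/-! ### Critical sections -/

/-- `z` is the end of the `unlock(a)` edge that closes the critical section of `a` opened at `y`. -/
def Closes (P : Program N X G M Ex Val) (t : Trace N X G M Ex Val) (a : M)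
    (y z : Node N X Val) : Prop :=
  (∃ x, (x, Action.unlock a, z) ∈ t.acts) ∧ P.tid z = P.tid y ∧ y.idx < z.idx ∧
    ∀ p p', (p, Action.unlock a, p') ∈ t.acts → P.tid p' = P.tid z → p'.idx < z.idx →
      p'.idx < y.idx

/-- `y` opens the critical section of `a` with `n` predecessors in the locking order. -/
inductive SectionAt (P : Program N X G M Ex Val) (t : Trace N X G M Ex Val) (a : M) :
    ℕ → Node N X Val → Prop
  | first (r y : Node N X Val) : P.IsRoot r → t.lk a r y → SectionAt P t a 0 y
  | next (n : ℕ) (y z y' : Node N X Val) : SectionAt P t a n y → Closes P t a y z → t.lk a z y' →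
      SectionAt P t a (n + 1) y'

section

variable {P : Program N X G M Ex Val} {t : Trace N X G M Ex Val} {a : M}

theorem Closes.unique (h : P.IsGlobalTrace t) {y z z' : Node N X Val} (h1 : Closes P t a y z)
    (h2 : Closes P t a y z') : z = z' := by
  obtain ⟨⟨x, e⟩, hid, hlt, hmin⟩ := h1
  obtain ⟨⟨x', e'⟩, hid', hlt', hmin'⟩ := h2
  refine h.node_eq (h.target_mem e) (h.target_mem e') (hid.trans hid'.symm) ?_
  rcases lt_trichotomy z.idx z'.idx with hc | hc | hc
  · have := hmin' x z e (hid.trans hid'.symm) hc; omega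
  · exact hc
  · have := hmin x' z' e' (hid'.trans hid.symm) hc; omega

theorem exists_closes (h : P.IsGlobalTrace t) {x z : Node N X Val}
    (e : (x, Action.unlock a, z) ∈ t.acts) :
    ∃ w y, (w, Action.lock a, y) ∈ t.acts ∧ Closes P t a y z := by
  obtain ⟨w, y, ew, hid, hidx, hmin⟩ := h.unlock_held a x z e
  have hz := h.idx_eq e
  refine ⟨w, y, ew, ⟨x, e⟩, ((h.tid_eq e).symm.trans hid.symm), by omega, ?_⟩
  intro p p' ep h1 h2
  exact hmin p p' ep (h1.trans (h.tid_eq e).symm) (by omega)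

/-- The root, the closing `unlock` of a section and the locking successor of a node are all unique,
so the chain of sections cannot branch. -/
theorem SectionAt.unique (h : P.IsGlobalTrace t) {n : ℕ} {y y' : Node N X Val}
    (h1 : SectionAt P t a n y) (h2 : SectionAt P t a n y') : y = y' := by
  induction h1 generalizing y' with
  | first r y hr hl =>
    cases h2 with
    | first r' _ hr' hl' =>
      obtain rfl := h.root_eq (h.lk_dom _ _ _ hl).1 (h.lk_dom _ _ _ hl').1 hr hr'
      exact h.lk_succ _ _ _ _ hl hl'
  | next n y z y₁ _ hc hl ih =>
    cases h2 with
    | next _ y' z' _ hs' hc' hl' =>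
      obtain rfl := ih hs'
      obtain rfl := hc.unique h hc'
      exact h.lk_succ _ _ _ _ hl hl'

theorem SectionAt.le_of_lt (h : P.IsGlobalTrace t) {m n : ℕ} {y y' : Node N X Val} (hmn : m < n)
    (h1 : SectionAt P t a m y) (h2 : SectionAt P t a n y') :
    ∃ z, Closes P t a y z ∧ t.Le z y' := by
  induction h2 with
  | first => omega
  | next n y₁ z y' hs hc hl ih =>
    rcases Nat.lt_succ_iff_lt_or_eq.1 hmn with hlt | rfl
    · obtain ⟨q, hq, hq'⟩ := ih hlt
      -- Reach the opening `y₁` of the preceding section, cross that section by program order, and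
      -- take the locking edge.
      refine ⟨q, hq, hq'.trans (.trans ?_ (IsGlobalTrace.lk_le hl))⟩
      obtain ⟨⟨x, e⟩, hid, hidx, -⟩ := hc
      have hy : y₁ ∈ t.nodes := by
        cases hs with
        | first _ _ _ hl => exact (h.imm_mem (.inr (.inr ⟨a, hl⟩))).2
        | next _ _ _ _ _ _ hl => exact (h.imm_mem (.inr (.inr ⟨a, hl⟩))).2
      exact h.le_of_idx_le hy (h.target_mem e) hid.symm hidx.le
    · obtain rfl := h1.unique h hs
      exact ⟨z, hc, IsGlobalTrace.lk_le hl⟩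

/-- Follow locking edges backwards: a predecessor is the root or closes a section opened causally
earlier. The descent stops because strict causality is well-founded on finitely many nodes. -/
theorem exists_sectionAt (h : P.IsGlobalTrace t) (hfin : t.nodes.Finite) {w y : Node N X Val}
    (e : (w, Action.lock a, y) ∈ t.acts) : ∃ n, SectionAt P t a n y := by
  have : IsStrictOrder (Node N X Val) (Relation.TransGen t.Imm) :=
    { irrefl := h.acyclic, trans := fun _ _ _ => Relation.TransGen.trans }
  have wf := hfin.wellFoundedOn (r := Relation.TransGen t.Imm)
  have hy := h.target_mem e
  revert w
  refine wf.induction (P := fun y => ∀ {w}, (w, Action.lock a, y) ∈ t.acts →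
    ∃ n, SectionAt P t a n y) hy fun y _ ih w e => ?_
  · obtain ⟨z, hz, -⟩ := h.lk_pred a w y e
    obtain ⟨hzn, hr | ⟨x, ex⟩, -⟩ := h.lk_dom _ _ _ hz
    · exact ⟨0, .first z y hr hz⟩
    · obtain ⟨w₁, y₁, e₁, hc⟩ := exists_closes h ex
      have h1 : t.Le y₁ z :=
        h.le_of_idx_le (h.target_mem e₁) hzn hc.2.1.symm hc.2.2.1.le
      obtain ⟨n, hn⟩ := ih y₁ (h.target_mem e₁)
        (Relation.TransGen.tail' h1 (.inr (.inr ⟨a, hz⟩))) e₁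
      exact ⟨n + 1, .next n y₁ z y hn hc hz⟩

/-- The critical sections of a mutex are totally ordered by causality. -/
theorem sections_total (h : P.IsGlobalTrace t) (hfin : t.nodes.Finite) {w y w' y' : Node N X Val}
    (e : (w, Action.lock a, y) ∈ t.acts) (e' : (w', Action.lock a, y') ∈ t.acts) :
    y = y' ∨ (∃ z, Closes P t a y z ∧ t.Le z y') ∨ ∃ z, Closes P t a y' z ∧ t.Le z y := by
  obtain ⟨m, hm⟩ := exists_sectionAt h hfin e
  obtain ⟨n, hn⟩ := exists_sectionAt h hfin e'
  rcases lt_trichotomy m n with hc | rfl | hc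
  · exact .inr (.inl (hm.le_of_lt h hc hn))
  · exact .inl (hm.unique h hn)
  · exact .inr (.inr (hn.le_of_lt h hc hm))

/-- A mutex still held at `p` since `y` can only be released after `p`. -/
theorem Closes.lt_of_mem_lockset {y z p : Node N X Val} (hc : Closes P t a y z)
    (hid : P.tid y = P.tid p)
    (hmin : ∀ q q', (q, Action.unlock a, q') ∈ t.acts → P.tid q' = P.tid p → q'.idx ≤ p.idx →
      q'.idx < y.idx) : p.idx < z.idx := by
  obtain ⟨⟨x, e⟩, hid', hlt, -⟩ := hc
  by_contra hle
  have := hmin x z e (hid'.trans hid) (by omega)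
  omega

/-- If a mutex is held at nodes `p`, `p'` of different threads, then one of these threads releases it
after its node and causally before the other thread acquires it. -/
theorem lockset_order (h : P.IsGlobalTrace t) (hfin : t.nodes.Finite) {p p' : Node N X Val}
    (hid : P.tid p ≠ P.tid p') (hp : a ∈ P.lockset t p) (hp' : a ∈ P.lockset t p') :
    (∃ x z w y, (x, Action.unlock a, z) ∈ t.acts ∧ P.tid z = P.tid p ∧ p.idx < z.idx ∧
      (w, Action.lock a, y) ∈ t.acts ∧ P.tid y = P.tid p' ∧ y.idx ≤ p'.idx ∧ t.Le z y) ∨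
    (∃ x z w y, (x, Action.unlock a, z) ∈ t.acts ∧ P.tid z = P.tid p' ∧ p'.idx < z.idx ∧
      (w, Action.lock a, y) ∈ t.acts ∧ P.tid y = P.tid p ∧ y.idx ≤ p.idx ∧ t.Le z y) := by
  obtain ⟨w, y, e, h1, h2, h3⟩ := hp
  obtain ⟨w', y', e', h1', h2', h3'⟩ := hp'
  rcases sections_total h hfin e e' with rfl | ⟨z, hz, hl⟩ | ⟨z, hz, hl⟩
  · exact absurd (h1.symm.trans h1') hid
  · obtain ⟨x, ex⟩ := hz.1
    exact .inl ⟨x, z, w', y', ex, hz.2.1.trans h1, hz.lt_of_mem_lockset h1 h3, e', h1', h2', hl⟩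
  · obtain ⟨x, ex⟩ := hz.1
    exact .inr ⟨x, z, w, y, ex, hz.2.1.trans h1', hz.lt_of_mem_lockset h1' h3', e, h1, h2, hl⟩

/-! ### Accesses to globals -/

/-- Atomicity forbids an access at the start point or at the start of a created thread, so the
access has a predecessor edge in its thread, which must be the `lock`. -/
theorem lock_before_access (hP : P.AtomicAccesses) (h : P.IsGlobalTrace t) {v v' : Node N X Val}
    {A : Action N X G M Ex} {g : G} (e : (v, A, v') ∈ t.acts) (hA : A.Accesses g) :
    ∃ w, (w, Action.lock (P.mutexOf g), v) ∈ t.acts := by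
  obtain ⟨h1, h2, h3, -⟩ := hP _ _ _ _ (h.edge_mem e) hA
  have hv := h.source_mem e
  by_cases h0 : v.idx = 0
  · by_cases hr : P.IsRoot v
    · exact absurd hr.2.1 h1
    · obtain ⟨z, hz, -⟩ := h.cr_pred v hv h0 hr
      obtain ⟨-, -, -, -, ⟨x, z', he⟩, -⟩ := h.cr_dom _ _ hz
      exact absurd he (h2 _ _ _)
  · obtain ⟨w, B, eB⟩ := h.exists_act_to hv h0
    obtain rfl := h3 _ _ (h.edge_mem eB)
    exact ⟨w, eB⟩

/-- A critical section in which `g` is accessed is only closed after the access. -/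
theorem access_le_close (h : P.IsGlobalTrace t) {v v' z : Node N X Val} {A : Action N X G M Ex}
    (e : (v, A, v') ∈ t.acts) (hc : Closes P t a v z) : v'.idx ≤ z.idx ∧ t.Le v' z := by
  obtain ⟨⟨x, ex⟩, hid, hlt, -⟩ := hc
  have := h.idx_eq e
  have hle : v'.idx ≤ z.idx := by omega
  exact ⟨hle, h.le_of_idx_le (h.target_mem e) (h.target_mem ex)
    ((h.tid_eq e).symm.trans hid.symm) hle⟩

/-- The writes to a global are totally ordered by causality. -/
theorem writes_total (hP : P.AtomicAccesses) (h : P.IsGlobalTrace t) (hfin : t.nodes.Finite)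
    {g : G} {w w' z z' : Node N X Val} {y y' : X} (e : (w, Action.write g y, w') ∈ t.acts)
    (e' : (z, Action.write g y', z') ∈ t.acts) : t.Le w' z' ∨ t.Le z' w' := by
  obtain ⟨p, ep⟩ := lock_before_access hP h e (.inr ⟨y, rfl⟩)
  obtain ⟨p', ep'⟩ := lock_before_access hP h e' (.inr ⟨y', rfl⟩)
  rcases sections_total h hfin ep ep' with rfl | ⟨q, hq, hl⟩ | ⟨q, hq, hl⟩
  -- In a common section both writes leave the node just after the `lock`, so they are the same
  -- edge.
  · exact .inl ((h.act_eq_of_source e e').1 ▸ .refl)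
  · exact .inl (((access_le_close h e hq).2.trans hl).trans (IsGlobalTrace.act_le e'))
  · exact .inr (((access_le_close h e' hq).2.trans hl).trans (IsGlobalTrace.act_le e))

/-! ### Last operations of the ego thread -/

theorem exists_max_idx (hfin : t.nodes.Finite) {p : Node N X Val → Prop}
    (hp : ∀ v, p v → v ∈ t.nodes) (hex : ∃ v, p v) :
    ∃ v, p v ∧ ∀ w, p w → w.idx ≤ v.idx := by
  obtain ⟨v, hv, hmax⟩ := Set.exists_max_image {v | p v} Node.idx (hfin.subset hp) hex
  exact ⟨v, hv, hmax⟩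

theorem exists_isLastTlLock (h : P.IsGlobalTrace t) (hfin : t.nodes.Finite) {w y : Node N X Val}
    (e : (w, Action.lock a, y) ∈ t.acts) (hid : P.tid y = P.tid t.sink) :
    ∃ v v', P.IsLastTlLock t a v v' := by
  obtain ⟨v', ⟨⟨v, ev⟩, hv⟩, hmax⟩ := exists_max_idx hfin
    (p := fun y => (∃ w, (w, Action.lock a, y) ∈ t.acts) ∧ P.tid y = P.tid t.sink)
    (fun v hv => by obtain ⟨⟨w, e⟩, -⟩ := hv; exact h.target_mem e) ⟨y, ⟨w, e⟩, hid⟩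
  exact ⟨v, v', ev, hv, fun z z' ez hz => hmax z' ⟨⟨z, ez⟩, hz⟩⟩

theorem IsLastTlLock_unique (h : P.IsGlobalTrace t) {v v' w w' : Node N X Val}
    (h1 : P.IsLastTlLock t a v v') (h2 : P.IsLastTlLock t a w w') : v = w ∧ v' = w' := by
  have hv := h.node_eq (h.target_mem h1.1) (h.target_mem h2.1) (h1.2.1.trans h2.2.1.symm)
    (le_antisymm (h2.2.2 _ _ h1.1 h1.2.1) (h1.2.2 _ _ h2.1 h2.2.1))
  subst hv
  exact ⟨(h.act_eq_of_target h1.1 h2.1).1, rfl⟩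

theorem IsLastTlWrite_unique (h : P.IsGlobalTrace t) {g : G} {v v' w w' : Node N X Val} {x y : X}
    (h1 : P.IsLastTlWrite t g v x v') (h2 : P.IsLastTlWrite t g w y w') :
    v = w ∧ x = y ∧ v' = w' := by
  have hv := h.node_eq (h.target_mem h1.1) (h.target_mem h2.1) (h1.2.1.trans h2.2.1.symm)
    (le_antisymm (h2.2.2 _ _ _ h1.1 h1.2.1) (h1.2.2 _ _ _ h2.1 h2.2.1))
  subst hv
  obtain ⟨h3, h4⟩ := h.act_eq_of_target h1.1 h2.1
  exact ⟨h3, by simpa using h4, rfl⟩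

theorem beta_locks_eq (h : P.IsGlobalTrace t) {v v' : Node N X Val}
    (hl : P.IsLastTlLock t a v v') : (P.beta t).2.1 a = single (P.lockset t v) := by
  have : {B | ∃ v v', P.IsLastTlLock t a v v' ∧ B = P.lockset t v} = {P.lockset t v} := by
    ext B
    constructor
    · rintro ⟨w, w', hw, rfl⟩
      rw [(IsLastTlLock_unique h hw hl).1]; rfl
    · rintro rfl; exact ⟨v, v', hl, rfl⟩
  change OrderDual.toDual (upperClosure _) = _
  rw [this, upperClosure_singleton]
  rfl

/-- In a local trace ending with a read of `g`, all writes to `g` precede the read. -/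
theorem write_le_of_read_sink (h : P.IsLocalTrace t) {v z z' : Node N X Val} {x y : X} {g : G}
    (e : (v, Action.read x g, t.sink) ∈ t.acts) (ez : (z, Action.write g y, z') ∈ t.acts) :
    t.Le z' v := by
  rcases Relation.ReflTransGen.cases_tail (h.sink_max z' (h.target_mem ez)) with hs | ⟨c, hc, hi⟩
  · rw [← hs] at ez
    exact absurd (h.act_eq_of_target e ez).2 (by simp)
  -- The end of a read is neither a thread's first node nor the end of a `lock`, so its only
  -- immediate predecessor is the source of the read.
  · rcases hi with ⟨A, eA⟩ | hcr | ⟨b, hlk⟩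
    · rwa [(h.act_eq_of_target e eA).1]
    · have h0 := (h.cr_dom _ _ hcr).2.2.1
      have := h.idx_eq e
      omega
    · obtain ⟨-, -, q, eq⟩ := h.lk_dom _ _ _ hlk
      exact absurd (h.act_eq_of_target e eq).2 (by simp)

/-- The origin of the value read from a global. -/
theorem read_origin (hP : P.AtomicAccesses) {k : Unk N M} (hr : Reach P k t) {v : Node N X Val}
    {x : X} {g : G} (e : (v, Action.read x g, t.sink) ∈ t.acts) :
    ∃ w y w', t.IsLastWrite g w y w' ∧ t.sink.st x = w.st y ∧
      (P.IsLastTlWrite t g w y w' ∨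
        ∃ a B S' f, f ∈ t.nodes ∧ f ≠ t.sink ∧ Reach P (.mx a) (t.restrict f) ∧
          P.lockset (t.restrict f) f = S' ∧
          P.IsLastTlWrite (t.restrict f) g w y w' ∧ (P.beta t).2.1 a = single B ∧ B ∩ S' = ∅ ∧
          g ∉ OrderDual.ofDual ((P.beta t).1 a)) := by
  have h := hr.isLocalTrace
  have hg := h.toIsGlobalTrace
  have hfin := hr.finite_nodes
  obtain ⟨w, y, w', ew, hle, hmax, hval⟩ := hg.globals x g v t.sink e
  -- The trace condition only gives a maximal write before the read; linearity of the writes makes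
  -- it the greatest.
  have hlast : ∀ z y' z', (z, Action.write g y', z') ∈ t.acts → t.Le z' w' := by
    intro z y' z' ez
    rcases writes_total hP hg hfin ew ez with hc | hc
    · rw [hmax z y' z' ez (write_le_of_read_sink h e ez) hc]; exact .refl
    · exact hc
  have hw' := hg.target_mem ew
  have htl : ∀ z y' z', (z, Action.write g y', z') ∈ t.acts → P.tid z' = P.tid w' →
      z'.idx ≤ w'.idx := fun z y' z' ez hid =>
    hg.idx_le_of_le (hg.target_mem ez) hw' hid (hlast z y' z' ez)
  refine ⟨w, y, w', ⟨ew, hlast⟩, hval, ?_⟩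
  by_cases hid : P.tid w' = P.tid t.sink
  · exact .inl ⟨ew, hid, fun z y' z' ez hz => htl z y' z' ez (hz.trans hid.symm)⟩
  right
  have hfirst : ∃ f, (∃ x a, (x, Action.unlock a, f) ∈ t.acts ∧ P.tid f = P.tid w' ∧
      w'.idx ≤ f.idx ∧ ∃ p p', P.IsLastTlLock t a p p' ∧ t.Le f p') := by
    obtain ⟨p, ep⟩ := lock_before_access hP hg e (.inl ⟨x, rfl⟩)
    obtain ⟨q, eq⟩ := lock_before_access hP hg ew (.inr ⟨y, rfl⟩)
    have hidv : P.tid v = P.tid t.sink := hg.tid_eq e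
    have hidw : P.tid w = P.tid w' := hg.tid_eq ew
    have hlastlock : P.IsLastTlLock t (P.mutexOf g) p v := by
      refine ⟨ep, hidv, fun z z' ez hz => ?_⟩
      have h1 := h.idx_le_sink (hg.target_mem ez) hz
      have h2 := hg.idx_eq e
      by_contra hc
      have := hg.node_eq (hg.target_mem ez) h.sink_mem hz (by omega)
      subst this
      exact absurd (hg.act_eq_of_target e ez).2 (by simp)
    rcases sections_total hg hfin eq ep with rfl | ⟨f, hf, hl⟩ | ⟨f, hf, hl⟩
    · exact absurd (hidw.symm.trans hidv) hid
    · obtain ⟨x', ex⟩ := hf.1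
      exact ⟨f, x', _, ex, hf.2.1.trans hidw, (access_le_close hg ew hf).1, p, v, hlastlock, hl⟩
    -- The ego section of `m_g` would close before the write and hence before the read inside it.
    · have h1 : t.Le f v := (hl.trans (IsGlobalTrace.act_le ew)).trans hle
      obtain ⟨x', ex⟩ := hf.1
      have := hg.idx_le_of_le (hg.target_mem ex) (hg.source_mem e) hf.2.1 h1
      have := hf.2.2.1
      omega
  -- The mutex varies together with the release: the latest candidate `f` may belong to a mutex
  -- other than `m_g`.
  obtain ⟨f, ⟨z, a, ef, hidf, hwf, p, p', hlock, hfp⟩, hfmax⟩ :=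
    exists_max_idx hfin (fun f hf => by obtain ⟨x, a, hx, -⟩ := hf; exact hg.target_mem hx) hfirst
  have hf := hg.target_mem ef
  have hw'f : t.Le w' f := hg.le_of_idx_le hw' hf hidf.symm hwf
  have hreach := (hr.restrict f hf).2 z a ef
  have hsub := t.restrict_sub f
  have hloc := hreach.isLocalTrace
  have hlocks := hsub.lockset_eq hloc.toIsGlobalTrace hg (v := f) hloc.sink_mem
  refine ⟨a, P.lockset t p, _, f, hf, ?_, hreach, rfl, ?_, beta_locks_eq hg hlock, ?_, ?_⟩
  · rintro rfl; exact hid hidf.symm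
  · exact ⟨⟨ew, hw'f⟩, hidf.symm, fun z y' z' ez hz => htl z y' z' ez.1 (hz.trans hidf)⟩
  · rw [← hlocks]
    rw [Set.eq_empty_iff_forall_notMem]
    rintro c ⟨hcp, hcf⟩
    have hidp : P.tid p = P.tid t.sink := (hg.tid_eq hlock.1).trans hlock.2.1
    have hpp := hg.idx_eq hlock.1
    rcases lockset_order hg hfin (fun hc => hid (hidf.symm.trans (hc.trans hidp))) hcf hcp with
      ⟨x', q, l, l', ex', hq, hlt, el, hl, -, hle'⟩ | ⟨x', q, l, l', ex', hq, hlt, el, hl, hl', hle'⟩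
    -- The writer releases `c` at `q`, after `f` and before an ego acquisition of `c`, hence before
    -- the last one: `q` is a later candidate.
    · obtain ⟨b, b', hb⟩ := exists_isLastTlLock hg hfin el (hl.trans hidp)
      have hlb : t.Le l' b' := hg.le_of_idx_le (hg.target_mem el) (hg.target_mem hb.1)
        ((hl.trans hidp).trans hb.2.1.symm) (hb.2.2 _ _ el (hl.trans hidp))
      have := hfmax q ⟨x', c, ex', hq.trans hidf, by omega, b, b', hb, hle'.trans hlb⟩
      omega
    -- The ego thread releases `c` at `q`, after `p` and so not before `p'`. This gives the cycle
    -- `p' ≤ q ≤ l' ≤ f ≤ p'` through two threads.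
    · have h1 : t.Le p' q := hg.le_of_idx_le (hg.target_mem hlock.1) (hg.target_mem ex')
        ((hg.tid_eq hlock.1).symm.trans hq.symm) (by omega)
      have h2 : t.Le l' f := hg.le_of_idx_le (hg.target_mem el) hf hl hl'
      have h3 := hg.le_antisymm hfp ((h1.trans hle').trans h2)
      subst h3
      exact hid (hidf.symm.trans hlock.2.1)
  · rintro ⟨z₁, y₁, z₁', hz₁, hz₁'⟩
    have h1 := hz₁' p p' hlock
    have h2 := hg.le_antisymm ((hw'f.trans hfp).trans h1) (hlast _ _ _ hz₁.1)
    exact hid (h2 ▸ hz₁.2.1)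

end

/-! ### Extending a local trace by an action of the ego thread -/

/-- The local trace `t` extends the causal past of `t₀` by an action `A` of the ego thread. -/
structure Extends (P : Program N X G M Ex Val) (t₀ : Trace N X G M Ex Val)
    (A : Action N X G M Ex) (t : Trace N X G M Ex Val) : Prop where
  loc₀ : P.IsLocalTrace t₀
  loc : P.IsLocalTrace t
  sub : t₀.Sub t
  act : (t₀.sink, A, t.sink) ∈ t.acts

namespace Extends

variable {P : Program N X G M Ex Val} {t₀ t : Trace N X G M Ex Val} {A : Action N X G M Ex}

theorem tid_sink (h : Extends P t₀ A t) : P.tid t₀.sink = P.tid t.sink := h.loc.tid_eq h.act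

theorem idx_sink (h : Extends P t₀ A t) : t.sink.idx = t₀.sink.idx + 1 := h.loc.idx_eq h.act

/-- Ego nodes before the new sink lie in the past of the old one. This holds for `lock` as well: the
merged trace brings no ego edge that is missing in `t₀`. -/
theorem ego_act_cases (h : Extends P t₀ A t) {w w' : Node N X Val} {B : Action N X G M Ex}
    (e : (w, B, w') ∈ t.acts) (hid : P.tid w' = P.tid t.sink) :
    ((w, B, w') ∈ t₀.acts ∧ P.tid w' = P.tid t₀.sink ∧ w'.idx ≤ t₀.sink.idx) ∨
      (w = t₀.sink ∧ B = A ∧ w' = t.sink) := by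
  have hidx := h.loc.idx_le_sink (h.loc.target_mem e) hid
  have hs := h.idx_sink
  rcases hidx.lt_or_eq with hlt | heq
  · have hid' := hid.trans h.tid_sink.symm
    have hle : w'.idx ≤ t₀.sink.idx := by omega
    refine .inl ⟨?_, hid', hle⟩
    exact h.sub.act_mem h.loc₀.toIsGlobalTrace h.loc.toIsGlobalTrace e
      (h.sub.mem_of_idx_le h.loc₀.toIsGlobalTrace h.loc.toIsGlobalTrace (h.loc.target_mem e)
        h.loc₀.sink_mem hid' hle)
  · obtain rfl := h.loc.node_eq (h.loc.target_mem e) h.loc.sink_mem hid heq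
    obtain ⟨rfl, rfl⟩ := h.loc.act_eq_of_target e h.act
    exact .inr ⟨rfl, rfl, rfl⟩

theorem ego_act_of (h : Extends P t₀ A t) {w w' : Node N X Val} {B : Action N X G M Ex}
    (e : (w, B, w') ∈ t₀.acts) (hid : P.tid w' = P.tid t₀.sink) :
    (w, B, w') ∈ t.acts ∧ P.tid w' = P.tid t.sink ∧ w'.idx < t.sink.idx := by
  have := h.loc₀.idx_le_sink (h.loc₀.target_mem e) hid
  have := h.idx_sink
  exact ⟨h.sub.acts e, hid.trans h.tid_sink, by omega⟩

theorem lockset_sink_iff (h : Extends P t₀ A t) {a : M} (h1 : A ≠ .lock a) (h2 : A ≠ .unlock a) :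
    a ∈ P.lockset t t.sink ↔ a ∈ P.lockset t₀ t₀.sink := by
  constructor
  · rintro ⟨w, w', e, hid, hidx, hmin⟩
    rcases h.ego_act_cases e hid with ⟨e', hid', hidx'⟩ | ⟨-, rfl, -⟩
    · refine ⟨w, w', e', hid', hidx', fun z z' ez hz _ => ?_⟩
      obtain ⟨f1, f2, f3⟩ := h.ego_act_of ez hz
      exact hmin z z' f1 f2 f3.le
    · exact absurd rfl h1
  · rintro ⟨w, w', e, hid, hidx, hmin⟩
    obtain ⟨f1, f2, f3⟩ := h.ego_act_of e hid
    refine ⟨w, w', f1, f2, f3.le, fun z z' ez hz _ => ?_⟩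
    rcases h.ego_act_cases ez hz with ⟨e', hid', hidx'⟩ | ⟨-, rfl, -⟩
    · exact hmin z z' e' hid' hidx'
    · exact absurd rfl h2

theorem lockset_sink (h : Extends P t₀ A t) :
    P.lockset t t.sink = postLocks A (P.lockset t₀ t₀.sink) := by
  ext b
  cases A with
  | lock a =>
    by_cases hb : b = a
    · subst hb
      refine iff_of_true ?_ (.inr rfl)
      refine ⟨_, _, h.act, rfl, le_rfl, fun z z' ez hz hle => ?_⟩
      rcases h.ego_act_cases ez hz with ⟨-, -, hlt⟩ | ⟨-, hc, -⟩
      · have := h.idx_sink; omega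
      · exact absurd hc (by simp)
    · rw [h.lockset_sink_iff (by simpa using Ne.symm hb) (by simp)]
      simp [postLocks, hb]
  | unlock a =>
    by_cases hb : b = a
    · subst hb
      refine iff_of_false ?_ (fun hc => hc.2 rfl)
      rintro ⟨w, w', e, hid, hidx, hmin⟩
      have := hmin _ _ h.act rfl le_rfl
      omega
    · rw [h.lockset_sink_iff (by simp) (by simpa using Ne.symm hb)]
      simp [postLocks, hb]
  | _ => exact h.lockset_sink_iff (by simp) (by simp)

theorem isLastTlWrite_iff (h : Extends P t₀ A t) {g : G} (hA : ∀ x, A ≠ .write g x)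
    {w w' : Node N X Val} {y : X} :
    P.IsLastTlWrite t g w y w' ↔ P.IsLastTlWrite t₀ g w y w' := by
  constructor
  · rintro ⟨e, hid, hmax⟩
    rcases h.ego_act_cases e hid with ⟨e', hid', -⟩ | ⟨-, hc, -⟩
    · exact ⟨e', hid', fun z y' z' ez hz =>
        hmax z y' z' (h.ego_act_of ez hz).1 (h.ego_act_of ez hz).2.1⟩
    · exact absurd hc.symm (hA y)
  · rintro ⟨e, hid, hmax⟩
    refine ⟨(h.ego_act_of e hid).1, (h.ego_act_of e hid).2.1, fun z y' z' ez hz => ?_⟩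
    rcases h.ego_act_cases ez hz with ⟨e', hid', -⟩ | ⟨-, hc, -⟩
    · exact hmax z y' z' e' hid'
    · exact absurd hc.symm (hA y')

theorem isLastTlWrite_sink (h : Extends P t₀ A t) {g : G} {x : X} (hA : A = .write g x) :
    P.IsLastTlWrite t g t₀.sink x t.sink :=
  ⟨hA ▸ h.act, rfl, fun _ _ _ ez hz => h.loc.idx_le_sink (h.loc.target_mem ez) hz⟩

theorem isLastTlLock_iff (h : Extends P t₀ A t) {a : M} (hA : A ≠ .lock a)
    {w w' : Node N X Val} :
    P.IsLastTlLock t a w w' ↔ P.IsLastTlLock t₀ a w w' := by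
  constructor
  · rintro ⟨e, hid, hmax⟩
    rcases h.ego_act_cases e hid with ⟨e', hid', -⟩ | ⟨-, hc, -⟩
    · exact ⟨e', hid', fun z z' ez hz =>
        hmax z z' (h.ego_act_of ez hz).1 (h.ego_act_of ez hz).2.1⟩
    · exact absurd hc.symm hA
  · rintro ⟨e, hid, hmax⟩
    refine ⟨(h.ego_act_of e hid).1, (h.ego_act_of e hid).2.1, fun z z' ez hz => ?_⟩
    rcases h.ego_act_cases ez hz with ⟨e', hid', -⟩ | ⟨-, hc, -⟩
    · exact hmax z z' e' hid'
    · exact absurd hc.symm hA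

theorem isLastTlLock_sink (h : Extends P t₀ A t) {a : M} (hA : A = .lock a) :
    P.IsLastTlLock t a t₀.sink t.sink :=
  ⟨hA ▸ h.act, rfl, fun _ _ ez hz => h.loc.idx_le_sink (h.loc.target_mem ez) hz⟩

/-- One inclusion suffices, as written sets are ordered by `⊇`. A new write is at the sink and so
follows every acquisition. -/
theorem mem_beta_written (h : Extends P t₀ A t) {a : M} {g : G} (hA : A ≠ .lock a)
    (hg : g ∈ OrderDual.ofDual ((P.beta t₀).1 a) ∨ ∃ x, A = .write g x) :
    g ∈ OrderDual.ofDual ((P.beta t).1 a) := by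
  by_cases hw : ∃ x, A = .write g x
  · obtain ⟨x, hx⟩ := hw
    exact ⟨_, _, _, h.isLastTlWrite_sink hx,
      fun v v' hv => h.loc.sink_max _ (h.loc.target_mem hv.1)⟩
  · obtain ⟨w, y, w', h1, h2⟩ := hg.resolve_right hw
    push Not at hw
    exact ⟨w, y, w', (h.isLastTlWrite_iff hw).2 h1,
      fun v v' hv => h.sub.le (h2 v v' ((h.isLastTlLock_iff hA).1 hv))⟩

theorem beta_locks_of_ne (h : Extends P t₀ A t) {a : M} (hA : A ≠ .lock a) :
    (P.beta t).2.1 a = (P.beta t₀).2.1 a := by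
  have : {B | ∃ v v', P.IsLastTlLock t a v v' ∧ B = P.lockset t v} =
      {B | ∃ v v', P.IsLastTlLock t₀ a v v' ∧ B = P.lockset t₀ v} := by
    ext B
    simp only [h.isLastTlLock_iff hA, Set.mem_ofPred_eq]
    refine exists₂_congr fun v v' => and_congr_right fun hv => ?_
    rw [h.sub.lockset_eq h.loc₀.toIsGlobalTrace h.loc.toIsGlobalTrace (h.loc₀.source_mem hv.1)]
  exact congrArg (fun T => OrderDual.toDual (upperClosure T)) this

theorem beta_locks_of_lock (h : Extends P t₀ A t) {a : M} (hA : A = .lock a) :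
    (P.beta t).2.1 a = single (P.lockset t₀ t₀.sink) := by
  rw [beta_locks_eq h.loc.toIsGlobalTrace (h.isLastTlLock_sink hA),
    h.sub.lockset_eq h.loc₀.toIsGlobalTrace h.loc.toIsGlobalTrace h.loc₀.sink_mem]

theorem beta_global_of_ne (h : Extends P t₀ A t) {g : G} (hA : ∀ x, A ≠ .write g x) :
    (P.beta t).2.2 (.inr g) = (P.beta t₀).2.2 (.inr g) := by
  ext d
  exact exists₃_congr fun w y w' => and_congr_left fun _ => h.isLastTlWrite_iff hA

theorem beta_global_of_write (h : Extends P t₀ A t) {g : G} {x : X} (hA : A = .write g x) :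
    (P.beta t).2.2 (.inr g) ⊆ {t₀.sink.st x} := by
  rintro d ⟨w, y, w', hw, rfl⟩
  obtain ⟨rfl, rfl, -⟩ := IsLastTlWrite_unique h.loc.toIsGlobalTrace hw (h.isLastTlWrite_sink hA)
  rfl

end Extends

/-! ### Soundness of Lock-Centered Reading -/

section

variable {D : Type u} {P : Program N X G M Ex Val}
  {𝒜 : Analysis N X G M Ex Val D}

/-- Covers initial traces and newly created threads alike: without ego edges, all components of `β`
except the locals are trivial. -/
theorem gammaPt_of_no_ego_act {t : Trace N X G M Ex Val} (ht : P.Traces t)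
    (hego : ∀ w A w', (w, A, w') ∈ t.acts → P.tid w' ≠ P.tid t.sink) {σ : X ⊕ G → D}
    (hσ : ∀ x, t.sink.st x ∈ 𝒜.conc (σ (.inl x))) :
    t ∈ gammaPt P 𝒜 t.sink.pt ∅
      (fun _ => OrderDual.toDual ∅, fun _ => OrderDual.toDual (upperClosure ∅), σ) := by
  refine ⟨ht, ?_, rfl, fun a => Set.empty_subset _, fun a => ?_, ?_⟩
  · refine Set.eq_empty_iff_forall_notMem.2 ?_
    rintro a ⟨w, w', e, hid, -⟩
    exact hego _ _ _ e hid
  · refine le_of_eq (congrArg (fun T => OrderDual.toDual (upperClosure T)) ?_)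
    refine Set.eq_empty_iff_forall_notMem.2 ?_
    rintro B ⟨w, w', h, -⟩
    exact hego _ _ _ h.1 h.2.1
  · rintro (x | g)
    · rintro _ rfl; exact hσ x
    · rintro d ⟨w, y, w', h, -⟩
      exact absurd h.2.1 (hego _ _ _ h.1)

theorem gammaPt_of_extends {t₀ t : Trace N X G M Ex Val} {A : Action N X G M Ex}
    (h : Extends P t₀ A t) (ht : P.Traces t) {u : N} {S : Set M} {s s' : State X G M D}
    (h₀ : t₀ ∈ gammaPt P 𝒜 u S s)
    (hV : ∀ a g, g ∈ OrderDual.ofDual (s'.1 a) →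
      A ≠ .lock a ∧ (g ∈ OrderDual.ofDual (s.1 a) ∨ ∃ x, A = .write g x))
    (hL : ∀ a, (A = .lock a ∧ s'.2.1 a = single S) ∨ (A ≠ .lock a ∧ s'.2.1 a = s.2.1 a))
    (hX : ∀ x, t.sink.st x ∈ 𝒜.conc (s'.2.2 (.inl x)))
    (hG : ∀ g, ((∀ x, A ≠ .write g x) ∧ (P.beta t₀).2.2 (.inr g) ⊆ 𝒜.conc (s'.2.2 (.inr g))) ∨
      ∃ x, A = .write g x ∧ t₀.sink.st x ∈ 𝒜.conc (s'.2.2 (.inr g))) :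
    t ∈ gammaPt P 𝒜 t.sink.pt (postLocks A S) s' := by
  obtain ⟨-, hS, -, h4, h5, h6⟩ := h₀
  refine ⟨ht, ?_, rfl, fun a g hg => ?_, fun a => ?_, ?_⟩
  · have hS' : P.lockset t₀ t₀.sink = S := hS
    exact hS' ▸ h.lockset_sink
  · obtain ⟨hA, hg⟩ := hV a g hg
    exact h.mem_beta_written hA (hg.imp_left fun hg => h4 a hg)
  · rcases hL a with ⟨hA, e⟩ | ⟨hA, e⟩
    · rw [e, h.beta_locks_of_lock hA]
      have hS' : P.lockset t₀ t₀.sink = S := hS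
      rw [hS']
    · rw [e, h.beta_locks_of_ne hA]
      exact h5 a
  · rintro (x | g)
    · rintro _ rfl; exact hX x
    · rcases hG g with ⟨hA, hg⟩ | ⟨x, hA, hg⟩
      · rwa [h.beta_global_of_ne hA]
      · exact (h.beta_global_of_write hA).trans (Set.singleton_subset_iff.2 hg)

theorem gammaPt_local {u : N} {S : Set M} {s : State X G M D} {t : Trace N X G M Ex Val}
    (h : t ∈ gammaPt P 𝒜 u S s) (x : X) : t.sink.st x ∈ 𝒜.conc (s.2.2 (.inl x)) :=
  h.2.2.2.2.2 (.inl x) rfl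

theorem gammaPt_global {u : N} {S : Set M} {s : State X G M D} {t : Trace N X G M Ex Val}
    (h : t ∈ gammaPt P 𝒜 u S s) (g : G) :
    (P.beta t).2.2 (.inr g) ⊆ 𝒜.conc (s.2.2 (.inr g)) :=
  h.2.2.2.2.2 (.inr g)

open Classical in
theorem update_local_mem {t₀ : Trace N X G M Ex Val} {u : N} {S : Set M} {s : State X G M D}
    (h₀ : t₀ ∈ gammaPt P 𝒜 u S s) {x : X} {v : Val} {d : D} (hv : v ∈ 𝒜.conc d) (z : X) :
    Function.update t₀.sink.st x v z ∈ 𝒜.conc (Function.update s.2.2 (.inl x) d (.inl z)) := by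
  by_cases hz : z = x
  · subst hz; simpa using hv
  · rw [Function.update_of_ne hz, Function.update_of_ne (by simpa using hz)]
    exact gammaPt_local h₀ z

variable [CompleteLattice D]

theorem gammaPt_mono (hm : Monotone 𝒜.conc) {u : N} {S : Set M} {s s' : State X G M D}
    (hs : s ≤ s') : gammaPt P 𝒜 u S s ⊆ gammaPt P 𝒜 u S s' := by
  rintro t ⟨h1, h2, h3, h4, h5, h6⟩
  exact ⟨h1, h2, h3, h4.trans hs.1, h5.trans hs.2.1, fun z => (h6 z).trans (hm (hs.2.2 z))⟩

/-- The soundness claim for the trace `t` at an unknown of the concrete system. -/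
def SoundAt (P : Program N X G M Ex Val) (𝒜 : Analysis N X G M Ex Val D)
    (η₂ : ∀ x, ADom N X G M D x) (t : Trace N X G M Ex Val) : Unk N M → Prop
  | .pt u => t ∈ gammaPt P 𝒜 u (P.lockset t t.sink) (η₂ (.pt u (P.lockset t t.sink)))
  | .mx a => ∀ g, t ∈ P.init ∪
      gammaGl P 𝒜 g a (P.lockset t t.sink) (η₂ (.gl g a (P.lockset t t.sink)))

/-- One step of the ego thread is soundly described by the abstract right-hand sides. -/
theorem sound_step (h𝒜 : 𝒜.Sound P) {η₂ : ∀ x, ADom N X G M D x}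
    (hη₂ : IsPostSolution (lockCentered P 𝒜) η₂) {t₀ t : Trace N X G M Ex Val} {u u' : N}
    {A : Action N X G M Ex} (he : (u, A, u') ∈ P.edges) (h : Extends P t₀ A t)
    (ht : P.Traces t) (h₀ : SoundAt P 𝒜 η₂ t₀ (.pt u)) (hpt : t.sink.pt = u')
    (hstep : P.Step A t₀.sink.st t.sink.st)
    (hcreate : ∀ x u₁, A = .create x u₁ → ∀ z, t.sink.st z =
      open Classical in Function.update t₀.sink.st x (P.nu t₀) z)
    (hread : ∀ x g, A = .read x g → t.sink.st x ∈ 𝒜.conc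
      ((arhs P 𝒜 u (P.lockset t₀ t₀.sink) A η₂).2.2.2 (.inl x))) :
    SoundAt P 𝒜 η₂ t (.pt u') := by
  classical
  subst hpt
  obtain ⟨S, hS⟩ : ∃ S, S = P.lockset t₀ t₀.sink := ⟨_, rfl⟩
  have hc := (hη₂ ⟨.pt t.sink.pt (postLocks A S), arhs P 𝒜 u S A⟩
    (.inr ⟨u, A, t.sink.pt, S, he, rfl⟩)).2
  change t ∈ gammaPt P 𝒜 _ _ _
  rw [h.lockset_sink, ← hS]
  rw [← hS] at hread
  replace h₀ : t₀ ∈ gammaPt P 𝒜 u S (η₂ (.pt u S)) := by rw [hS]; exact h₀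
  refine gammaPt_mono h𝒜.conc_mono hc ?_
  refine gammaPt_of_extends h ht h₀ ?_ ?_ ?_ ?_
  · intro a g hg
    cases A with
    | lock b =>
      by_cases hb : a = b
      · subst hb
        simp [arhs] at hg
      · simp only [arhs, Function.update_of_ne hb] at hg
        exact ⟨by simpa using Ne.symm hb, .inl hg⟩
    | write g' x =>
      rcases hg with hg | rfl
      · exact ⟨by simp, .inl hg⟩
      · exact ⟨by simp, .inr ⟨x, rfl⟩⟩
    | _ => exact ⟨by simp, .inl hg⟩
  · intro a
    cases A with
    | lock b =>
      by_cases hb : a = b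
      · subst hb
        exact .inl ⟨rfl, by simp [arhs]⟩
      · exact .inr ⟨by simpa using Ne.symm hb, by simp only [arhs, Function.update_of_ne hb]⟩
    | _ => exact .inr ⟨by simp, rfl⟩
  · intro z
    cases A with
    | guard r =>
      obtain ⟨hne, hst⟩ := hstep
      rw [hst]
      exact (h𝒜.guard r _ (fun g => (P.beta t₀).2.2 (.inr g)) _ (gammaPt_local h₀)
        (gammaPt_global h₀) hne).1 z
    | assign x r =>
      rw [show t.sink.st = _ from hstep]
      exact update_local_mem h₀ (h𝒜.eval r _ _ (gammaPt_local h₀)) z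
    | create x u₁ =>
      rw [hcreate x u₁ rfl z]
      exact update_local_mem h₀ (h𝒜.nu u x u₁ _ S _ t₀ he h₀) z
    | read x g =>
      obtain ⟨d, hd⟩ := hstep
      -- The local step leaves the value read arbitrary, so its soundness has to come from outside,
      -- through `hread`.
      have hx := hread x g rfl
      rw [hd]
      rw [hd, Function.update_self] at hx
      refine update_local_mem h₀ ?_ z
      simpa [arhs] using hx
    | lock a => rw [show t.sink.st = _ from hstep]; exact gammaPt_local h₀ z
    | unlock a => rw [show t.sink.st = _ from hstep]; exact gammaPt_local h₀ z
    | write g x =>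
      rw [show t.sink.st = _ from hstep]
      simpa [arhs] using gammaPt_local h₀ z
  · intro g
    have hg := gammaPt_global h₀ g
    cases A with
    | guard r =>
      exact .inl ⟨by simp, (h𝒜.guard r _ (fun g => (P.beta t₀).2.2 (.inr g)) _ (gammaPt_local h₀)
        (gammaPt_global h₀) hstep.1).2 g⟩
    | write g' x =>
      by_cases hb : g = g'
      · subst hb
        exact .inr ⟨x, rfl, by simpa [arhs] using gammaPt_local h₀ x⟩
      · exact .inl ⟨by simpa using fun h => absurd h.symm hb, by simpa [arhs, hb] using hg⟩
    | lock a => exact .inl ⟨by simp, hg⟩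
    | unlock a => exact .inl ⟨by simp, hg⟩
    | _ => exact .inl ⟨by simp, by simp only [arhs]; rwa [Function.update_of_ne (by simp)]⟩

theorem extends_of_mem_sem {t₀ t : Trace N X G M Ex Val} {u u' : N} {A : Action N X G M Ex}
    (h₀ : P.IsLocalTrace t₀) (ht : t ∈ P.sem u A u' t₀) : Extends P t₀ A t :=
  ⟨h₀, ht.1, sub_of_mem_sem ht, by rw [ht.2.2.2.2.2.2.2.1]; exact Set.mem_insert _ _⟩

theorem extends_of_mem_semLock {t₀ t₁ t : Trace N X G M Ex Val} {u u' : N} {a : M}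
    (h₀ : P.IsLocalTrace t₀) (ht : t ∈ P.semLock u a u' t₀ t₁) : Extends P t₀ (.lock a) t :=
  ⟨h₀, ht.1, sub_left_of_mem_semLock ht, by rw [ht.2.2.2.2.2.1]; exact Set.mem_insert _ _⟩

/-- The new sink is not a node of `t₀`; otherwise it would lie below the sink of `t₀` and close a
cycle. -/
theorem ncard_lt_of_imm_sink {t₀ t : Trace N X G M Ex Val} (h₀ : P.IsLocalTrace t₀)
    (h : P.IsLocalTrace t) (hfin : t.nodes.Finite) (hsub : t₀.Sub t)
    (hi : t.Imm t₀.sink t.sink) : t₀.nodes.ncard < t.nodes.ncard := by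
  refine Set.ncard_lt_ncard ⟨hsub.nodes, fun hc => ?_⟩ hfin
  have := hsub.le (h₀.sink_max _ (hc h.sink_mem))
  exact h.acyclic _ (Relation.TransGen.tail' this hi)

/-- The two cases of `read_origin` match the two operands of the join: an own write is covered by `σ
g`, a foreign one by the unknown `[g,a,S']`. -/
theorem read_value_mem (hP : P.AtomicAccesses) (h𝒜 : 𝒜.Sound P) {η₂ : ∀ x, ADom N X G M D x}
    {t₀ t : Trace N X G M Ex Val} {k : Unk N M} {u : N} {x : X} {g : G} (hr : Reach P k t)
    (h : Extends P t₀ (.read x g) t) (h₀ : SoundAt P 𝒜 η₂ t₀ (.pt u))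
    (ih : ∀ k s, Reach P k s → s.nodes.ncard < t.nodes.ncard → SoundAt P 𝒜 η₂ s k) :
    t.sink.st x ∈ 𝒜.conc
      ((arhs P 𝒜 u (P.lockset t₀ t₀.sink) (.read x g) η₂).2.2.2 (.inl x)) := by
  obtain ⟨w, y, w', -, hval, hcase⟩ := read_origin hP hr h.act
  rw [hval]
  simp only [arhs, Function.update_self]
  rcases hcase with hw | ⟨a, B, S', f, hf, hne, hreach, hS', hw, hB, hdisj, hg⟩
  · refine h𝒜.conc_mono le_sup_left (gammaPt_global h₀ g ?_)
    exact ⟨w, y, w', (h.isLastTlWrite_iff (by simp)).1 hw, rfl⟩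
  · have hlt : (t.restrict f).nodes.ncard < t.nodes.ncard := by
      refine Set.ncard_lt_ncard ⟨(t.restrict_sub f).nodes, fun hc => hne ?_⟩ hr.finite_nodes
      exact h.loc.le_antisymm (h.loc.sink_max f hf) (hc h.loc.sink_mem).2
    have hv : w.st y ∈ 𝒜.conc (η₂ (.gl g a S')) := by
      -- The past of `f` contains a write by its ego thread, which rules out an initial trace and a
      -- trace without such a write.
      rcases ih (.mx a) _ hreach hlt g with ⟨σ, -, e⟩ | ⟨-, -, -, z, y', z', hz, hc⟩ | ⟨-, -, -, hc⟩
      · have := hw.1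
        rw [e] at this
        exact this.elim
      · obtain ⟨rfl, rfl, -⟩ := IsLastTlWrite_unique hreach.isLocalTrace.toIsGlobalTrace hw hz
        rw [← hS']; exact hc
      · exact absurd ⟨w, y, w', hw⟩ hc
    refine h𝒜.conc_mono (le_sup_of_le_right (le_sSup ?_)) hv
    -- Abstract written sets underapproximate and abstract lockset families overapproximate the
    -- concrete ones, so the concrete conditions on `a`, `B` and `S'` carry over.
    refine ⟨a, S', B, fun hc => hg ?_, ?_, hdisj, rfl⟩
    · exact h.mem_beta_written (by simp) (.inl (h₀.2.2.2.1 a hc))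
    · have h5 := h₀.2.2.2.2.1 a
      rw [← h.beta_locks_of_ne (by simp), hB] at h5
      exact h5 (UpperSet.mem_Ici_iff.2 le_rfl)

/-- Induction is on the number of nodes, not on the derivation of `Reach`: the causal past used at a
read need not be a premise of the last rule. -/
theorem sound_of_reach (hP : P.AtomicAccesses) (h𝒜 : 𝒜.Sound P) {η₂ : ∀ x, ADom N X G M D x}
    (hη₂ : IsPostSolution (lockCentered P 𝒜) η₂) {k : Unk N M} {t : Trace N X G M Ex Val}
    (hr : Reach P k t) : SoundAt P 𝒜 η₂ t k := by
  classical
  induction hn : t.nodes.ncard using Nat.strong_induction_on generalizing k t with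
  | _ n ih =>
  subst hn
  replace ih : ∀ k s, Reach P k s → s.nodes.ncard < t.nodes.ncard → SoundAt P 𝒜 η₂ s k :=
    fun k s hs hlt => ih _ hlt hs rfl
  cases hr with
  | init_pt _ hi =>
    have hr := Reach.init_pt _ hi
    obtain ⟨σ, hσ, rfl⟩ := hi
    have hc := (hη₂ ⟨.pt P.start ∅, fun _ => (⊥, initState)⟩ (.inl rfl)).2
    have hmem := gammaPt_of_no_ego_act (𝒜 := 𝒜) hr.traces (fun _ _ _ e => e.elim)
      (σ := Sum.elim (fun _ => ⊤) (fun _ => ⊥)) (fun x => by simp [h𝒜.conc_top])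
    have hS : P.lockset (P.initTrace σ) (P.initTrace σ).sink = ∅ := hmem.2.1
    change _ ∈ gammaPt P 𝒜 _ _ _
    rw [hS]
    exact gammaPt_mono h𝒜.conc_mono hc hmem
  | init_mx a _ hi => exact fun g => .inl hi
  | new u x u₁ u' t₀ _ he h₀ ht =>
    have hr := Reach.new u x u₁ u' t₀ t he h₀ ht
    have hloc := hr.isLocalTrace
    have hs₀ : SoundAt P 𝒜 η₂ t₀ (.pt u) := ih _ t₀ h₀ (ncard_lt_of_imm_sink h₀.isLocalTrace hloc
      hr.finite_nodes (sub_of_mem_new ht) (.inr (.inl ((ht.2.2.2.2.1 _ _).2 (.inr ⟨rfl, rfl⟩)))))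
    have hpt : t.sink.pt = u₁ := by rw [ht.2.1]
    have hc := (effect_le_iff _ _ _).1 (hη₂
      ⟨.pt u' (postLocks (Action.create x u₁) (P.lockset t₀ t₀.sink)), arhs P 𝒜 u _ _⟩
      (.inr ⟨u, _, u', _, he, rfl⟩)).1
    have hmem := gammaPt_of_no_ego_act (𝒜 := 𝒜) hr.traces (fun w A w' e hid => by
        have h1 := hloc.idx_eq e
        have h2 := hloc.idx_le_sink (hloc.target_mem e) hid
        have h3 : t.sink.idx = 0 := by rw [ht.2.1]
        omega)
      (σ := Sum.elim (Function.update
        (fun y => (η₂ (.pt u (P.lockset t₀ t₀.sink))).2.2 (.inl y)) P.self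
        (𝒜.nuA u (η₂ (.pt u (P.lockset t₀ t₀.sink))) u₁)) (fun _ => ⊥)) (fun z => by
        rw [ht.2.1]
        by_cases hz : z = P.self
        · subst hz
          simpa using h𝒜.nu u x u₁ u' _ _ t₀ he hs₀
        · simpa [hz] using gammaPt_local hs₀ z)
    have hS : P.lockset t t.sink = ∅ := hmem.2.1
    change _ ∈ gammaPt P 𝒜 _ _ _
    rw [hS]
    rw [hpt] at hmem
    exact gammaPt_mono h𝒜.conc_mono hc hmem
  | edge u A u' t₀ _ he hA h₀ ht =>
    have hr := Reach.edge u A u' t₀ t he hA h₀ ht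
    have hE := extends_of_mem_sem h₀.isLocalTrace ht
    have hs₀ : SoundAt P 𝒜 η₂ t₀ (.pt u) := ih _ t₀ h₀ (ncard_lt_of_imm_sink h₀.isLocalTrace
      hr.isLocalTrace hr.finite_nodes hE.sub (.inl ⟨_, hE.act⟩))
    refine sound_step h𝒜 hη₂ he hE hr.traces hs₀ ht.2.2.2.1 ht.2.2.2.2.1 ?_ ?_
    · intro x u₁ e z
      rw [ht.2.2.2.2.2.1 x u₁ e]
    · rintro x g rfl
      exact read_value_mem hP h𝒜 hr hE hs₀ ih
  | unlock_mx u a u' t₀ _ he h₀ ht =>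
    have hr := Reach.unlock_mx u a u' t₀ t he h₀ ht
    have hE := extends_of_mem_sem h₀.isLocalTrace ht
    have hs₀ : SoundAt P 𝒜 η₂ t₀ (.pt u) := ih _ t₀ h₀ (ncard_lt_of_imm_sink h₀.isLocalTrace
      hr.isLocalTrace hr.finite_nodes hE.sub (.inl ⟨_, hE.act⟩))
    intro g
    right
    by_cases hw : ∃ w y w', P.IsLastTlWrite t g w y w'
    · left
      refine ⟨hr.traces, rfl, ⟨_, hE.act⟩, ?_⟩
      obtain ⟨w, y, w', hw⟩ := hw
      refine ⟨w, y, w', hw, ?_⟩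
      -- At `[a]` the side-effect of the `unlock` constraint is used, not its contribution to
      -- `[u',S']`.
      have hc := (hη₂
        ⟨.pt u' (postLocks (Action.unlock a) (P.lockset t₀ t₀.sink)), arhs P 𝒜 u _ _⟩
        (.inr ⟨u, _, u', _, he, rfl⟩)).1 (.gl g a (P.lockset t₀ t₀.sink \ {a}))
      have hS : P.lockset t t.sink = P.lockset t₀ t₀.sink \ {a} := hE.lockset_sink
      rw [hS]
      simp only [arhs, and_self, if_true] at hc
      refine h𝒜.conc_mono hc (gammaPt_global hs₀ g ?_)
      exact ⟨w, y, w', (hE.isLastTlWrite_iff (by simp)).1 hw, rfl⟩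
    · exact .inr ⟨hr.traces, rfl, ⟨_, hE.act⟩, hw⟩
  | lock u a u' t₀ t₁ _ he h₀ h₁ ht =>
    have hr := Reach.lock u a u' t₀ t₁ t he h₀ h₁ ht
    have hE := extends_of_mem_semLock h₀.isLocalTrace ht
    have hs₀ : SoundAt P 𝒜 η₂ t₀ (.pt u) := ih _ t₀ h₀ (ncard_lt_of_imm_sink h₀.isLocalTrace
      hr.isLocalTrace hr.finite_nodes hE.sub (.inl ⟨_, hE.act⟩))
    refine sound_step h𝒜 hη₂ he hE hr.traces hs₀ (by rw [ht.2.2.2.1])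
      (show t.sink.st = t₀.sink.st by rw [ht.2.2.2.1]) ?_ ?_
    · intro x u₁ e; simp at e
    · intro x g e; simp at e

end

end LockCentered

open LockCentered
theorem theorem5 {N X G M Ex Val D : Type u} [CompleteLattice D]
    (P : Program N X G M Ex Val) (hP : P.AtomicAccesses)
    (𝒜 : Analysis N X G M Ex Val D) (h𝒜 : 𝒜.Sound P) :
    -- the local trace semantics: the least solution of the concrete constraint system
    ∃ η : ∀ x, TraceDom N X G M Ex Val x, IsLeast {η | IsPostSolution P.traceSystem η} η ∧
      -- soundness of every post-solution of Lock-Centered Reading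
      (∀ η₂ : ∀ x, ADom N X G M D x, IsPostSolution (lockCentered P 𝒜) η₂ →
        (∀ u S, η (.pt u) ∩ P.withLocks S ⊆ gammaPt P 𝒜 u S (η₂ (.pt u S))) ∧
        (∀ g a S, η (.mx a) ∩ P.withLocks S ⊆
          P.init ∪ gammaGl P 𝒜 g a S (η₂ (.gl g a S)))) ∧
      -- origin of the values read from globals
      (∀ u x g, ∀ t ∈ η (.pt u), t.LastIs (.read x g) →
        ∃ w y w', t.IsLastWrite g w y w' ∧ t.sink.st x = w.st y ∧
          (P.IsLastTlWrite t g w y w' ∨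
            ∃ a B S', ∃ t' ∈ η (.mx a) ∩ P.withLocks S', P.IsLastTlWrite t' g w y w' ∧
              (P.beta t).2.1 a = single B ∧ B ∩ S' = ∅ ∧
              g ∉ OrderDual.ofDual ((P.beta t).1 a))) := by
  refine ⟨fun x => {t | Reach P x t}, isLeast_reach P, ?_, ?_⟩
  · intro η₂ hη₂
    refine ⟨?_, ?_⟩
    · rintro u _ t ⟨hr, rfl⟩
      exact sound_of_reach hP h𝒜 hη₂ hr
    · rintro g a _ t ⟨hr, rfl⟩
      exact sound_of_reach hP h𝒜 hη₂ hr g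
  · rintro u x g t hr ⟨v, e⟩
    obtain ⟨w, y, w', h1, h2, h3 | ⟨a, B, S', f, -, -, h3, h4, h5, h6, h7, h8⟩⟩ :=
      read_origin hP hr e
    · exact ⟨w, y, w', h1, h2, .inl h3⟩
    · exact ⟨w, y, w', h1, h2, .inr ⟨a, B, S', t.restrict f, ⟨h3, h4⟩, h5, h6, h7, h8⟩⟩
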